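/- **Proposition.** There are universal constants $c,c'>0$ such that the following holds. Let $\|\cdot\|$ be a norm on $\mathbb R^n$, let $\mu$ be a Borel probability measure on $\mathbb R^n$, let $p\ge 2$, $\frac1q=1-\frac1p$ and $\mathbf c_0>0$. For a Borel set $A\subset\mathbb R^n$ put $$\mu^+(A)=\liminf_{\varepsilon\to0+}\frac{\mu(A_\varepsilon)-\mu(A)}{\varepsilon},\qquad A_\varepsilon=\{x:\exists y\in A,\ \|x-y\|<\varepsilon\},\qquad \widetilde{\mu(A)}=\min(\mu(A),1-\mu(A)),$$ and for $F:\mathbb R^n\to\mathbb R$ put $\|\nabla F\|_*(x)=\limsup_{y\to x}\frac{|F(y)-F(x)|}{\|y-x\|}$. Suppose that $$\mu^+(A)\ \ge\ \mathbf c_0\,\widetilde{\mu(A)}\,\log^{1/q}\frac1{\widetilde{\mu(A)}}\qquad\text{for all Borel sets }A\subset\mathbb R^n$$ (the right-hand side being $0$ when $\widetilde{\mu(A)}=0$). Then: 1. For every $t\in(0,1/2)$ and every locally Lipschitz $F:\mathbb R^n\to[0,1]$ with $\mu\{F=1\}\ge t$ and $\mu\{F=0\}\ge 1/2$, $$\int\|\nabla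 F\|_*\,d\mu\ \ge\ \mathbf c_0\,\min\Big(t\log^{1/q}\tfrac1t,\ \tfrac12\log^{1/q}2\Big);$$ in particular, if $t\le\frac14$ or $q\ge\frac1{\log 2}$, then $\int\|\nabla F\|_*\,d\mu\ge\mathbf c_0\,t\log^{1/q}\frac1t$. 2. For every $t\in(0,1/2)$ and every locally Lipschitz $F:\mathbb R^n\to[0,1]$ with $\mu\{F=1\}\ge t$ and $\mu\{F=0\}\ge 1/2$, $$\int\|\nabla F\|_*^q\,d\mu\ \ge\ c\,\mathbf c_0^q\,t\log\tfrac1t .$$ 3. For every locally Lipschitz $F:\mathbb R^n\to[0,\infty)$, $$\int\|\nabla F\|_*^q\,d\mu\ \ge\ c'\,\mathbf c_0^q\int F^q\log\frac{F^q}{\int F^q\,d\mu}\,d\mu .$$ Here, if the left-hand side is finite, then $F^q$ and $F^q\log\big(F^q/\int F^q\,d\mu\big)$ are $\mu$-integrable; if it is infinite, the inequality is understood to hold trivially. -/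

import Mathlib

open MeasureTheory Filter Topology
open scoped ENNReal

/-- The Minkowski boundary measure
`μ⁺(A) = liminf_{ε → 0+} (μ(A_ε) - μ(A)) / ε`, where
`A_ε = {x | ∃ y ∈ A, ‖x - y‖ < ε}` is the open `ε`-extension of `A`.
It takes values in `[0, ∞]`. -/
noncomputable def minkowskiBoundary {E : Type*} [NormedAddCommGroup E] [MeasurableSpace E]
    (μ : Measure E) (A : Set E) : ℝ≥0∞ :=
  liminf (fun ε : ℝ => (μ (Metric.thickening ε A) - μ A) / ENNReal.ofReal ε) (𝓝[>] (0 : ℝ))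

/-- `min (μ(A), 1 - μ(A))`. -/
noncomputable def minMass {E : Type*} [MeasurableSpace E] (μ : Measure E) (A : Set E) : ℝ :=
  min (μ.real A) (1 - μ.real A)

/-- The function `s ↦ s log^{1/q}(1/s)`, with value `0` at `s = 0`. -/
noncomputable def logProfile (q s : ℝ) : ℝ :=
  s * Real.log (1 / s) ^ (1 / q)

/-- `‖∇F‖_*(x) = limsup_{y → x} |F(y) - F(x)| / ‖y - x‖`, the limsup being over `y ≠ x`,
as an element of `[0, ∞]`. -/
noncomputable def gradNorm {E : Type*} [NormedAddCommGroup E] (F : E → ℝ) (x : E) : ℝ≥0∞ :=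
  limsup (fun y : E => ENNReal.ofReal (|F y - F x| / ‖y - x‖)) (𝓝[≠] x)

/-!
The whole proposition follows from two facts about the level sets of `F`.

*Coarea.* For a bounded nonnegative locally Lipschitz function `F` and a continuous monotone
weight `w`, the isoperimetric hypothesis applied to the sets `{s < F}` gives
`∫ w(s) c₀ I(min (μ{F > s}, 1 - μ{F > s})) ds ≤ ∫ w(F) ‖∇F‖_* dμ`, where `I = logProfile q`
(`lintegral_mul_logProfile_le`). For Lipschitz `F` this is Fatou's lemma for the difference
quotients `(μ(A_ε) - μ(A)) / ε`; locally Lipschitz functions are reached by truncation, which is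
where finite dimension is used.

*The central estimate.* Let `G ≥ 0` be positive with probability at most `1/2`, let `b ≥ ∫ G^q`, and
put `Λ(s) = log (max 2 (s^q / b))`. By Markov's inequality `log (1 / μ{G > s}) ≥ Λ(s)`, so the
coarea inequality with weight `s^(q-1) Λ(s)^(1/p)`, the layer cake formula and Hölder's inequality
yield `c₀^q ∫ G^q Λ(G) ≤ 64 ∫ ‖∇G‖_*^q` (`rpow_mul_lintegral_levelLog_le`). This is a Poincaré and a
logarithmic Sobolev inequality at once.

The `L¹` inequality is the coarea inequality with `w = 1`, since the level sets in question have
measure in `[t, 1/2]` and the profile is at least its smaller endpoint value there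
(`min_logProfile_le`). For the `q`-log-Sobolev inequality the central estimate is applied to the
positive and negative parts of `F - m`, with `m` a median, and the entropy of `F^q` is recentred
(`rpow_mul_log_sub_add_le`, `integrable_and_entropy_le`). The capacity inequality is a consequence
of the log-Sobolev inequality, because the entropy of `F^q` is at least `(a/2) log (1/a)` for
`a = μ{F = 1}` when `μ{F > 0} ≤ 1/2` (`negMulLog_measureReal_le_entropy`).
-/

open scoped NNReal

/-! ### The local Lipschitz constant -/

section GradNorm

variable {E : Type*} [NormedAddCommGroup E]

theorem gradNorm_le_of_abs_sub_le {F G : E → ℝ} (h : ∀ x y, |G y - G x| ≤ |F y - F x|) (x : E) :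
    gradNorm G x ≤ gradNorm F x :=
  limsup_le_limsup (Eventually.of_forall fun y =>
    ENNReal.ofReal_le_ofReal (div_le_div_of_nonneg_right (h x y) (norm_nonneg _)))

theorem eventually_abs_sub_le_of_gradNorm_lt {F : E → ℝ} {x : E} {g : ℝ≥0}
    (h : gradNorm F x < g) : ∀ᶠ y in 𝓝 x, |F y - F x| ≤ g * ‖y - x‖ := by
  have h1 := eventually_lt_of_limsup_lt h
  rw [eventually_nhdsWithin_iff] at h1
  filter_upwards [h1] with y hy
  by_cases hyx : y = x
  · simp [hyx]
  · have h2 := (hy hyx).le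
    rw [ENNReal.ofReal_le_iff_le_toReal ENNReal.coe_ne_top, ENNReal.coe_toReal] at h2
    rwa [div_le_iff₀ (norm_pos_iff.2 (sub_ne_zero.2 hyx))] at h2

theorem gradNorm_le_of_eventually {F : E → ℝ} {x : E} {g : ℝ≥0}
    (h : ∀ᶠ y in 𝓝 x, |F y - F x| ≤ g * ‖y - x‖) : gradNorm F x ≤ g := by
  refine limsup_le_of_le (by isBoundedDefault) ?_
  rw [eventually_nhdsWithin_iff]
  filter_upwards [h] with y hy hyx
  rw [ENNReal.ofReal_le_iff_le_toReal ENNReal.coe_ne_top, ENNReal.coe_toReal,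
    div_le_iff₀ (norm_pos_iff.2 (sub_ne_zero.2 hyx))]
  exact hy

/-- If the increments of `G` are bounded by those of `F` up to a `δ`-Lipschitz error, then so are
the local Lipschitz constants. -/
theorem gradNorm_le_add {F G : E → ℝ} {δ : ℝ≥0}
    (h : ∀ x y, |G y - G x| ≤ |F y - F x| + δ * ‖y - x‖) (x : E) :
    gradNorm G x ≤ gradNorm F x + δ := by
  by_cases htop : gradNorm F x = ∞
  · simp [htop]
  refine ENNReal.le_of_forall_pos_le_add fun η hη _ => ?_
  lift gradNorm F x to ℝ≥0 using htop with g hg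
  have hlt : gradNorm F x < ((g + η : ℝ≥0) : ℝ≥0∞) := by
    rw [← hg]; exact_mod_cast lt_add_of_pos_right g hη
  have := gradNorm_le_of_eventually (F := G) (x := x) (g := g + η + δ) (by
    filter_upwards [eventually_abs_sub_le_of_gradNorm_lt hlt] with y hy
    refine (h x y).trans ?_
    push_cast at hy ⊢
    linarith)
  refine this.trans (le_of_eq ?_)
  push_cast
  ring

end GradNorm

/-! ### The coarea inequality -/

section Coarea

variable {E : Type*} [NormedAddCommGroup E]

/-- The levels `s` whose superlevel set `{s < F}` misses `x` but comes `ε`-close to it fill at most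
the interval from `F x` to an upper bound of `F` on the ball `B(x, ε)`. -/
theorem lintegral_thickening_levels_le {F : E → ℝ} {w : ℝ → ℝ} (hw : Monotone w) {x : E} {ε : ℝ}
    {g : ℝ≥0} (h : ∀ y ∈ Metric.ball x ε, F y ≤ F x + g * ε) :
    (∫⁻ s, {s | x ∈ Metric.thickening ε {y | s < F y} ∧ F x ≤ s}.indicator
      (fun s => ENNReal.ofReal (w s)) s) / ENNReal.ofReal ε
      ≤ ENNReal.ofReal (w (F x + g * ε)) * g := by
  have h1 : (∫⁻ s, {s | x ∈ Metric.thickening ε {y | s < F y} ∧ F x ≤ s}.indicator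
      (fun s => ENNReal.ofReal (w s)) s) ≤
      ∫⁻ s, (Set.Icc (F x) (F x + g * ε)).indicator
        (fun _ => ENNReal.ofReal (w (F x + g * ε))) s := by
    refine lintegral_mono fun s => ?_
    refine Set.indicator_apply_le' (fun hs => ?_) (fun _ => zero_le)
    obtain ⟨hs1, hs2⟩ := hs
    obtain ⟨y, hy, hxy⟩ := Metric.mem_thickening_iff.1 hs1
    have hsy : s ≤ F x + g * ε :=
      (Set.mem_ofPred.1 hy).le.trans (h y (by rwa [Metric.mem_ball, dist_comm]))
    rw [Set.indicator_of_mem (show s ∈ Set.Icc (F x) (F x + g * ε) from ⟨hs2, hsy⟩)]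
    exact ENNReal.ofReal_le_ofReal (hw hsy)
  rw [lintegral_indicator measurableSet_Icc, lintegral_const, Measure.restrict_apply_univ,
    Real.volume_Icc, add_sub_cancel_left, ENNReal.ofReal_mul (p := (g : ℝ)) g.2, ← mul_assoc] at h1
  refine ENNReal.div_le_of_le_mul (h1.trans (le_of_eq ?_))
  rw [ENNReal.ofReal_coe_nnreal]

variable [MeasurableSpace E] [BorelSpace E]

theorem measurableSet_thickening_levels {F : E → ℝ} (hF : Continuous F) (ε : ℝ) :
    MeasurableSet {z : E × ℝ | z.1 ∈ Metric.thickening ε {y | z.2 < F y} ∧ F z.1 ≤ z.2} := by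
  have heq : {z : E × ℝ | z.1 ∈ Metric.thickening ε {y | z.2 < F y}} =
      ⋃ y, Metric.ball y ε ×ˢ Set.Iio (F y) := by
    ext z
    simp [Metric.mem_thickening_iff, and_comm]
  have hopen : IsOpen {z : E × ℝ | z.1 ∈ Metric.thickening ε {y | z.2 < F y}} := by
    rw [heq]
    exact isOpen_iUnion fun y => Metric.isOpen_ball.prod isOpen_Iio
  exact hopen.measurableSet.inter
    (measurableSet_le (hF.measurable.comp measurable_fst) measurable_snd)

/-- Weighted coarea inequality for bounded Lipschitz functions. The difference quotients
`(μ(A_ε) - μ(A)) / ε` of all superlevel sets `A = {s < F}` are integrated over `s`; Fatou's lemma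
bounds this from below, and Fubini together with the reverse Fatou lemma, which is where the global
Lipschitz bound enters, from above. -/
theorem lintegral_mul_minkowskiBoundary_le {μ : Measure E} [IsProbabilityMeasure μ] {F : E → ℝ}
    {L : ℝ≥0} (hF : LipschitzWith L F) {N : ℝ} (hN : ∀ x, F x ≤ N) {w : ℝ → ℝ} (hw : Monotone w)
    (hwc : Continuous w) :
    ∫⁻ s, ENNReal.ofReal (w s) * minkowskiBoundary μ {x | s < F x}
      ≤ ∫⁻ x, ENNReal.ofReal (w (F x)) * gradNorm F x ∂μ := by
  set ε : ℕ → ℝ := fun n => 1 / ((n : ℝ) + 1) with hεdef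
  have hε : ∀ n, 0 < ε n := fun n => Nat.one_div_pos_of_nat
  have hε1 : ∀ n, ε n ≤ 1 := fun n => by
    rw [hεdef]; exact (div_le_one (by positivity)).2 (by linarith [Nat.cast_nonneg (α := ℝ) n])
  have hεlim : Tendsto ε atTop (𝓝 0) := tendsto_one_div_add_atTop_nhds_zero_nat
  have hεlim' : Tendsto ε atTop (𝓝[>] 0) :=
    tendsto_nhdsWithin_iff.2 ⟨hεlim, Eventually.of_forall hε⟩
  set T : ℕ → Set (E × ℝ) := fun n =>
    {z | z.1 ∈ Metric.thickening (ε n) {y | z.2 < F y} ∧ F z.1 ≤ z.2} with hTdef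
  have hT : ∀ n, MeasurableSet (T n) := fun n => measurableSet_thickening_levels hF.continuous _
  set h : ℕ → E × ℝ → ℝ≥0∞ := fun n => (T n).indicator (fun z => ENNReal.ofReal (w z.2)) with hh
  have hhm : ∀ n, Measurable (h n) := fun n =>
    ((ENNReal.measurable_ofReal.comp hwc.measurable).comp measurable_snd).indicator (hT n)
  set f : ℕ → E → ℝ≥0∞ := fun n x => (∫⁻ s, h n (x, s)) / ENNReal.ofReal (ε n) with hf
  have hfm : ∀ n, Measurable (f n) := fun n => (hhm n).lintegral_prod_right'.div_const _
  have hsec : ∀ n s, ∫⁻ x, h n (x, s) ∂μ =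
      ENNReal.ofReal (w s) * (μ (Metric.thickening (ε n) {x | s < F x}) - μ {x | s < F x}) := by
    intro n s
    have hsub : {x | s < F x} ⊆ Metric.thickening (ε n) {x | s < F x} :=
      Metric.self_subset_thickening (hε n) _
    have hm : MeasurableSet {x | s < F x} :=
      measurableSet_lt measurable_const hF.continuous.measurable
    rw [← measure_sdiff hsub hm.nullMeasurableSet (measure_ne_top _ _),
      ← lintegral_indicator_const (Metric.isOpen_thickening.measurableSet.diff hm)]
    refine lintegral_congr fun x => ?_
    have hiff : (x, s) ∈ T n ↔ x ∈ Metric.thickening (ε n) {x | s < F x} \ {x | s < F x} := by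
      exact and_congr_right fun _ => not_lt.symm
    by_cases hx : (x, s) ∈ T n
    · simp only [hh]
      rw [Set.indicator_of_mem hx, Set.indicator_of_mem (hiff.1 hx)]
    · simp only [hh]
      rw [Set.indicator_of_notMem hx, Set.indicator_of_notMem (mt hiff.2 hx)]
  have hfle : ∀ n x (g : ℝ≥0), (∀ y ∈ Metric.ball x (ε n), F y ≤ F x + g * ε n) →
      f n x ≤ ENNReal.ofReal (w (F x + g * ε n)) * g := fun n x g hg =>
    lintegral_thickening_levels_le hw hg
  calc ∫⁻ s, ENNReal.ofReal (w s) * minkowskiBoundary μ {x | s < F x}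
      ≤ ∫⁻ s, liminf (fun n => (∫⁻ x, h n (x, s) ∂μ) / ENNReal.ofReal (ε n)) atTop := by
        refine lintegral_mono fun s => ?_
        simp only [hsec, mul_div_assoc]
        rw [ENNReal.liminf_const_mul_of_ne_top ENNReal.ofReal_ne_top]
        gcongr
        exact liminf_le_liminf_of_le (u := fun e : ℝ =>
          (μ (Metric.thickening e {x | s < F x}) - μ {x | s < F x}) / ENNReal.ofReal e) hεlim'
    _ ≤ liminf (fun n => ∫⁻ s, (∫⁻ x, h n (x, s) ∂μ) / ENNReal.ofReal (ε n)) atTop :=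
        lintegral_liminf_le fun n => (hhm n).lintegral_prod_left'.div_const _
    _ = liminf (fun n => ∫⁻ x, f n x ∂μ) atTop := by
        congr 1
        ext n
        simp only [hf, div_eq_mul_inv]
        rw [lintegral_mul_const _ (hhm n).lintegral_prod_left',
          lintegral_mul_const _ (hhm n).lintegral_prod_right',
          lintegral_lintegral_swap (f := fun x s => h n (x, s)) (hhm n).aemeasurable]
    _ ≤ limsup (fun n => ∫⁻ x, f n x ∂μ) atTop := liminf_le_limsup
    _ ≤ ∫⁻ x, limsup (fun n => f n x) atTop ∂μ := by
        refine limsup_lintegral_le (fun _ => ENNReal.ofReal (w (N + L)) * L) hfm (fun n => ?_) ?_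
        · refine Eventually.of_forall fun x => (hfle n x L fun y hy => ?_).trans ?_
          · have h1 := hF.dist_le_mul y x
            have h2 : (L : ℝ) * dist y x ≤ L * ε n := by
              gcongr
              exact (Metric.mem_ball.1 hy).le
            rw [Real.dist_eq] at h1
            linarith [le_abs_self (F y - F x)]
          · change _ ≤ ENNReal.ofReal (w (N + L)) * L
            gcongr
            refine hw (add_le_add (hN x) ?_)
            exact mul_le_of_le_one_right L.2 (hε1 n)
        · rw [lintegral_const]
          finiteness
    _ ≤ ∫⁻ x, ENNReal.ofReal (w (F x)) * gradNorm F x ∂μ := by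
        refine lintegral_mono fun x => ?_
        have hfin : gradNorm F x ≤ L := gradNorm_le_of_eventually
          (Eventually.of_forall fun y => by simpa [dist_eq_norm] using hF.dist_le_mul y x)
        have hkey : ∀ g : ℝ≥0, gradNorm F x < g →
            limsup (fun n => f n x) atTop ≤ ENNReal.ofReal (w (F x)) * g := by
          intro g hg
          obtain ⟨r, hr, hball⟩ :=
            Metric.eventually_nhds_iff_ball.1 (eventually_abs_sub_le_of_gradNorm_lt hg)
          have hlim : Tendsto (fun n => ENNReal.ofReal (w (F x + g * ε n)) * g) atTop
              (𝓝 (ENNReal.ofReal (w (F x)) * g)) := by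
            refine ENNReal.Tendsto.mul_const ?_ (Or.inr ENNReal.coe_ne_top)
            refine (ENNReal.continuous_ofReal.tendsto _).comp ((hwc.tendsto _).comp ?_)
            simpa using (hεlim.const_mul (g : ℝ)).const_add (F x)
          rw [← hlim.limsup_eq]
          refine limsup_le_limsup ?_
          filter_upwards [hεlim.eventually_lt_const hr] with n hn
          refine hfle n x g fun y hy => ?_
          have h1 := hball y (Metric.ball_subset_ball hn.le hy)
          have h2 : (g : ℝ) * ‖y - x‖ ≤ g * ε n := by
            gcongr
            rw [← dist_eq_norm]
            exact (Metric.mem_ball.1 hy).le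
          linarith [le_abs_self (F y - F x)]
        lift gradNorm F x to ℝ≥0 using ne_top_of_le_ne_top ENNReal.coe_ne_top hfin with G hG
        have hlim : Tendsto (fun g : ℝ≥0 => ENNReal.ofReal (w (F x)) * (g : ℝ≥0∞)) (𝓝[>] G)
            (𝓝 (ENNReal.ofReal (w (F x)) * G)) :=
          ENNReal.Tendsto.const_mul ((ENNReal.continuous_coe.tendsto G).mono_left
            nhdsWithin_le_nhds) (Or.inr ENNReal.ofReal_ne_top)
        refine ge_of_tendsto hlim ?_
        filter_upwards [self_mem_nhdsWithin] with g hg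
        exact hkey g (by exact_mod_cast hg)

end Coarea

/-! ### Truncation of locally Lipschitz functions -/

section Cutoff

variable {E : Type*} [NormedAddCommGroup E]

/-- The truncation `min F (n - ‖x‖ / (n + 1))₊`. For `F ≥ 0` it vanishes outside a bounded set and
increases to `F` as `n → ∞`; its local Lipschitz constant exceeds that of `F` by at most
`1 / (n + 1)`. -/
noncomputable def cutoff (F : E → ℝ) (n : ℕ) (x : E) : ℝ :=
  min (F x) (max 0 (n - ‖x‖ / (n + 1)))

variable {F : E → ℝ}

theorem cutoff_le (n : ℕ) (x : E) : cutoff F n x ≤ F x := min_le_left _ _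

theorem cutoff_mono (x : E) : Monotone fun n => cutoff F n x := by
  intro n m hnm
  have : (n : ℝ) ≤ m := by exact_mod_cast hnm
  change min _ (max 0 ((n : ℝ) - ‖x‖ / (n + 1))) ≤ min _ (max 0 ((m : ℝ) - ‖x‖ / (m + 1)))
  gcongr

theorem exists_cutoff_eq (x : E) : ∃ n, cutoff F n x = F x := by
  obtain ⟨n, hn⟩ := exists_nat_ge (F x + ‖x‖)
  refine ⟨n, min_eq_left (le_max_of_le_right ?_)⟩
  have : ‖x‖ / (n + 1) ≤ ‖x‖ := div_le_self (norm_nonneg _) (by simp)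
  linarith

theorem abs_cone_sub_le (n : ℕ) (x y : E) :
    |max 0 ((n : ℝ) - ‖y‖ / (n + 1)) - max 0 (n - ‖x‖ / (n + 1))|
      ≤ (1 / ((n : ℝ≥0) + 1) : ℝ≥0) * ‖y - x‖ := by
  refine (abs_max_sub_max_le_max _ _ _ _).trans ?_
  have h1 : |(n : ℝ) - ‖y‖ / (n + 1) - (n - ‖x‖ / (n + 1))| = |‖y‖ - ‖x‖| / (n + 1) := by
    rw [← abs_of_pos (show (0 : ℝ) < n + 1 by positivity), ← abs_div,
      abs_of_pos (show (0 : ℝ) < n + 1 by positivity), abs_sub_comm]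
    congr 1
    ring
  rw [sub_self, abs_zero, h1, max_eq_right (by positivity)]
  push_cast
  rw [one_div, inv_mul_eq_div]
  gcongr
  exact abs_norm_sub_norm_le y x

theorem abs_cutoff_sub_le (n : ℕ) (x y : E) :
    |cutoff F n y - cutoff F n x| ≤ |F y - F x| + (1 / ((n : ℝ≥0) + 1) : ℝ≥0) * ‖y - x‖ :=
  (abs_min_sub_min_le_max _ _ _ _).trans <|
    max_le (le_add_of_nonneg_right (by positivity))
      ((abs_cone_sub_le n x y).trans (le_add_of_nonneg_left (abs_nonneg _)))

theorem exists_lipschitzWith_cutoff [ProperSpace E] (hF : LocallyLipschitz F) (h0 : ∀ x, 0 ≤ F x)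
    (n : ℕ) : ∃ L, LipschitzWith L (cutoff F n) := by
  obtain ⟨K, hK⟩ := (hF.locallyLipschitzOn (s := Metric.closedBall (0 : E) (n * (n + 1)))
    ).exists_lipschitzOnWith_of_compact (isCompact_closedBall _ _)
  set δ : ℝ≥0 := 1 / ((n : ℝ≥0) + 1)
  -- outside the closed ball of radius `n (n + 1)` the truncation vanishes
  have hout : ∀ x y : E, y ∉ Metric.closedBall (0 : E) (n * (n + 1)) →
      |cutoff F n y - cutoff F n x| ≤ δ * ‖y - x‖ := by
    intro x y hy
    have hy' : (n : ℝ) * (n + 1) < ‖y‖ := by simpa using hy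
    have hcy : max 0 ((n : ℝ) - ‖y‖ / (n + 1)) = 0 :=
      max_eq_left (by rw [sub_nonpos, le_div_iff₀ (by positivity)]; exact hy'.le)
    have hFy : cutoff F n y = 0 := by rw [cutoff, hcy, min_eq_right (h0 y)]
    have hx0 : 0 ≤ cutoff F n x := le_min (h0 x) (le_max_left _ _)
    have h1 := abs_cone_sub_le n x y
    rw [hcy, zero_sub, abs_neg, abs_of_nonneg (le_max_left _ _)] at h1
    rw [hFy, zero_sub, abs_neg, abs_of_nonneg hx0]
    exact (min_le_right _ _).trans h1
  refine ⟨K + δ, LipschitzWith.of_dist_le_mul fun x y => ?_⟩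
  rw [dist_comm, dist_comm x y, Real.dist_eq, dist_eq_norm, NNReal.coe_add, add_mul]
  by_cases hy : y ∈ Metric.closedBall (0 : E) (n * (n + 1))
  · by_cases hx : x ∈ Metric.closedBall (0 : E) (n * (n + 1))
    · have h1 := hK.dist_le_mul y hy x hx
      rw [Real.dist_eq, dist_eq_norm] at h1
      linarith [abs_cutoff_sub_le (F := F) n x y]
    · have h1 := hout y x hx
      rw [abs_sub_comm, norm_sub_rev] at h1
      have : 0 ≤ (K : ℝ) * ‖y - x‖ := by positivity
      linarith
  · have : 0 ≤ (K : ℝ) * ‖y - x‖ := by positivity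
    linarith [hout x y hy]

end Cutoff

/-! ### The isoperimetric profile and its argument -/

section Profile

theorem measurable_logProfile (q : ℝ) : Measurable (logProfile q) := by
  unfold logProfile
  fun_prop

theorem continuousAt_logProfile {q s : ℝ} (h0 : 0 < s) (h1 : s < 1) :
    ContinuousAt (logProfile q) s := by
  have hlog : Real.log (1 / s) ≠ 0 :=
    (Real.log_pos ((one_lt_div h0).2 h1)).ne'
  unfold logProfile
  have h1s : (1 : ℝ) / s ≠ 0 := (one_div_pos.2 h0).ne'
  refine continuousAt_id.mul (ContinuousAt.rpow_const ?_ (Or.inl hlog))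
  exact (continuousAt_const.div continuousAt_id h0.ne').log h1s

variable {E : Type*} [MeasurableSpace E] {μ : Measure E}

theorem minMass_nonneg [IsProbabilityMeasure μ] (A : Set E) : 0 ≤ minMass μ A :=
  le_min measureReal_nonneg (sub_nonneg.2 measureReal_le_one)

theorem minMass_le_half (A : Set E) : minMass μ A ≤ 1 / 2 := by
  unfold minMass
  rcases le_total (μ.real A) (1 / 2) with h | h
  · exact (min_le_left _ _).trans h
  · exact (min_le_right _ _).trans (by linarith)

theorem minMass_eq_of_le_half {A : Set E} (h : μ.real A ≤ 1 / 2) : minMass μ A = μ.real A :=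
  min_eq_left (by linarith)

end Profile

/-! ### The coarea inequality for locally Lipschitz functions -/

section CoareaLocal

variable {E : Type*} [NormedAddCommGroup E] [NormedSpace ℝ E] [FiniteDimensional ℝ E]
  [MeasurableSpace E] [BorelSpace E] {μ : Measure E} [IsProbabilityMeasure μ]

/-- The functional form of the isoperimetric inequality: the hypothesis on `μ⁺` is integrated
over the superlevel sets of a bounded locally Lipschitz function. The function is approximated by
its truncations, which are globally Lipschitz. -/
theorem lintegral_mul_logProfile_le {q c₀ : ℝ}
    (hiso : ∀ A : Set E, MeasurableSet A →
      ENNReal.ofReal (c₀ * logProfile q (minMass μ A)) ≤ minkowskiBoundary μ A)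
    {F : E → ℝ} (hF : LocallyLipschitz F) (h0 : ∀ x, 0 ≤ F x) {N : ℝ} (hN : ∀ x, F x ≤ N)
    {w : ℝ → ℝ} (hw : Monotone w) (hwc : Continuous w) :
    ∫⁻ s, ENNReal.ofReal (w s) * ENNReal.ofReal (c₀ * logProfile q (minMass μ {x | s < F x}))
      ≤ ∫⁻ x, ENNReal.ofReal (w (F x)) * gradNorm F x ∂μ := by
  have := FiniteDimensional.proper ℝ E
  set δ : ℕ → ℝ≥0 := fun n => 1 / ((n : ℝ≥0) + 1) with hδ
  have hmassreal : ∀ s, Tendsto (fun n => minMass μ {x | s < cutoff F n x}) atTop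
      (𝓝 (minMass μ {x | s < F x})) := by
    intro s
    have hU : {x | s < F x} = ⋃ n, {x | s < cutoff F n x} := by
      ext x
      simp only [Set.mem_ofPred_eq, Set.mem_iUnion]
      constructor
      · intro h
        obtain ⟨n, hn⟩ := exists_cutoff_eq (F := F) x
        exact ⟨n, hn ▸ h⟩
      · rintro ⟨n, hn⟩
        exact hn.trans_le (cutoff_le n x)
    have h1 : Tendsto (fun n => μ {x | s < cutoff F n x}) atTop (𝓝 (μ {x | s < F x})) := by
      rw [hU]
      exact tendsto_measure_iUnion_atTop fun n m hnm x hx =>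
        lt_of_lt_of_le (Set.mem_ofPred.1 hx) (cutoff_mono x hnm)
    have h2 : Tendsto (fun n => μ.real {x | s < cutoff F n x}) atTop (𝓝 (μ.real {x | s < F x})) :=
      (ENNReal.tendsto_toReal (measure_ne_top _ _)).comp h1
    exact h2.min (h2.const_sub 1)
  have hmeas : ∀ n, Measurable fun s => minMass μ {x | s < cutoff F n x} := by
    intro n
    have hanti : Antitone fun s => μ.real {x | s < cutoff F n x} := fun s t hst =>
      measureReal_mono fun x hx => lt_of_le_of_lt hst (Set.mem_ofPred.1 hx)
    exact hanti.measurable.min (hanti.measurable.const_sub 1)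
  calc ∫⁻ s, ENNReal.ofReal (w s) * ENNReal.ofReal (c₀ * logProfile q (minMass μ {x | s < F x}))
      ≤ ∫⁻ s, liminf (fun n => ENNReal.ofReal (w s) *
          ENNReal.ofReal (c₀ * logProfile q (minMass μ {x | s < cutoff F n x}))) atTop := by
        refine lintegral_mono fun s => ?_
        -- the profile vanishes at mass `0`, so only its continuity at positive masses matters
        rcases (minMass_nonneg (μ := μ) {x | s < F x}).eq_or_lt with hz | hpos
        · rw [← hz]
          simp [logProfile]
        · have hlim : Tendsto (fun n => ENNReal.ofReal (w s) *
              ENNReal.ofReal (c₀ * logProfile q (minMass μ {x | s < cutoff F n x}))) atTop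
              (𝓝 (ENNReal.ofReal (w s) *
                ENNReal.ofReal (c₀ * logProfile q (minMass μ {x | s < F x})))) := by
            refine ENNReal.Tendsto.const_mul ((ENNReal.continuous_ofReal.tendsto _).comp
              (Tendsto.const_mul _ ?_)) (Or.inr ENNReal.ofReal_ne_top)
            exact (continuousAt_logProfile hpos
              ((minMass_le_half _).trans_lt (by norm_num))).tendsto.comp (hmassreal s)
          exact hlim.liminf_eq.ge
    _ ≤ liminf (fun n => ∫⁻ s, ENNReal.ofReal (w s) *
          ENNReal.ofReal (c₀ * logProfile q (minMass μ {x | s < cutoff F n x}))) atTop :=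
        lintegral_liminf_le fun n => hwc.measurable.ennreal_ofReal.mul
          (((measurable_logProfile q).comp (hmeas n)).const_mul c₀).ennreal_ofReal
    _ ≤ liminf (fun n => ∫⁻ x, ENNReal.ofReal (w (F x)) * gradNorm F x ∂μ
          + ENNReal.ofReal (w N) * δ n) atTop := by
        refine liminf_le_liminf (Eventually.of_forall fun n => ?_)
        obtain ⟨L, hL⟩ := exists_lipschitzWith_cutoff hF h0 n
        calc ∫⁻ s, ENNReal.ofReal (w s) *
              ENNReal.ofReal (c₀ * logProfile q (minMass μ {x | s < cutoff F n x}))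
            ≤ ∫⁻ s, ENNReal.ofReal (w s) * minkowskiBoundary μ {x | s < cutoff F n x} := by
              refine lintegral_mono fun s => ?_
              gcongr
              exact hiso _ (measurableSet_lt measurable_const hL.continuous.measurable)
          _ ≤ ∫⁻ x, ENNReal.ofReal (w (cutoff F n x)) * gradNorm (cutoff F n) x ∂μ :=
              lintegral_mul_minkowskiBoundary_le hL (fun x => (cutoff_le n x).trans (hN x)) hw hwc
          _ ≤ ∫⁻ x, (ENNReal.ofReal (w (F x)) * gradNorm F x + ENNReal.ofReal (w N) * δ n) ∂μ := by
              refine lintegral_mono fun x => ?_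
              have h1 : ENNReal.ofReal (w (cutoff F n x)) ≤ ENNReal.ofReal (w (F x)) :=
                ENNReal.ofReal_le_ofReal (hw (cutoff_le n x))
              have h2 : ENNReal.ofReal (w (F x)) ≤ ENNReal.ofReal (w N) :=
                ENNReal.ofReal_le_ofReal (hw (hN x))
              calc _ ≤ ENNReal.ofReal (w (F x)) * (gradNorm F x + δ n) :=
                    mul_le_mul' h1 (gradNorm_le_add (abs_cutoff_sub_le n) x)
                _ ≤ _ := by
                    rw [mul_add]
                    gcongr
          _ = _ := by
              rw [lintegral_add_right _ measurable_const, lintegral_const, measure_univ, mul_one]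
    _ = ∫⁻ x, ENNReal.ofReal (w (F x)) * gradNorm F x ∂μ := by
        refine Tendsto.liminf_eq ?_
        have hδ0 : Tendsto (fun n => ((δ n : ℝ≥0) : ℝ≥0∞)) atTop (𝓝 0) := by
          rw [← ENNReal.coe_zero, ENNReal.tendsto_coe]
          exact tendsto_one_div_add_atTop_nhds_zero_nat
        simpa using (ENNReal.Tendsto.const_mul (a := ENNReal.ofReal (w N)) hδ0
          (Or.inr ENNReal.ofReal_ne_top)).const_add
            (∫⁻ x, ENNReal.ofReal (w (F x)) * gradNorm F x ∂μ)

end CoareaLocal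

/-! ### Lower bounds for the isoperimetric profile -/

section ProfileBounds

theorem logProfile_eq_negMulLog {q s : ℝ} (hq : 0 < q) (h0 : 0 < s) (h1 : s ≤ 1) :
    logProfile q s = (Real.negMulLog (s ^ q) / q) ^ (1 / q) := by
  have hlog : 0 ≤ Real.log (1 / s) := Real.log_nonneg ((one_le_div h0).2 h1)
  have : Real.negMulLog (s ^ q) / q = s ^ q * Real.log (1 / s) := by
    rw [Real.negMulLog, Real.log_rpow h0, one_div, Real.log_inv]
    field_simp
  rw [this, Real.mul_rpow (by positivity) hlog, ← Real.rpow_mul h0.le, mul_one_div_cancel hq.ne',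
    Real.rpow_one, logProfile]

/-- On an interval, the profile is at least its smaller endpoint value: its `q`-th power is, up to a
change of variables, the concave function `u ↦ -u log u`. -/
theorem min_logProfile_le {q t m : ℝ} (hq : 0 < q) (ht : 0 < t) (htm : t ≤ m) (hm : m ≤ 1 / 2) :
    min (logProfile q t) (logProfile q (1 / 2)) ≤ logProfile q m := by
  rw [logProfile_eq_negMulLog hq ht (by linarith),
    logProfile_eq_negMulLog hq (by norm_num) (by norm_num),
    logProfile_eq_negMulLog hq (ht.trans_le htm) (by linarith)]
  have hmono : ∀ {x y : ℝ}, 0 < x → x ≤ 1 → Real.negMulLog (x ^ q) ≤ y →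
      (Real.negMulLog (x ^ q) / q) ^ (1 / q) ≤ (y / q) ^ (1 / q) := fun hx0 hx1 hxy => by
    have := Real.negMulLog_nonneg (Real.rpow_nonneg hx0.le q) (Real.rpow_le_one hx0.le hx1 hq.le)
    gcongr
  have := Real.concaveOn_negMulLog.min_le_of_mem_Icc (x := t ^ q) (y := (1 / 2 : ℝ) ^ q)
    (z := m ^ q) (Set.mem_Ici.2 (by positivity)) (Set.mem_Ici.2 (by positivity))
    ⟨by gcongr, Real.rpow_le_rpow (ht.trans_le htm).le hm hq.le⟩
  rw [min_le_iff] at this ⊢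
  exact this.imp (hmono ht (by linarith)) (hmono (by norm_num) (by norm_num))

theorem logProfile_le_logProfile_half {q t : ℝ} (hq : 1 ≤ q) (ht : 0 < t) (ht2 : t < 1 / 2)
    (h : t ≤ 1 / 4 ∨ 1 / Real.log 2 ≤ q) : logProfile q t ≤ logProfile q (1 / 2) := by
  have hq0 : 0 < q := by linarith
  have hl2 : 0 < Real.log 2 := Real.log_pos one_lt_two
  have hl2' := Real.log_two_gt_d9
  set v := (2 * t) ^ q with hv
  have hv0 : 0 < v := by positivity
  have hlogt : 0 ≤ Real.log (1 / t) := Real.log_nonneg ((one_le_div ht).2 (by linarith))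
  -- both cases amount to the inequality `(2t)^q log (1/t) ≤ log 2`
  have key : v * Real.log (1 / t) ≤ Real.log 2 := by
    rcases h with h | h
    · have hv1 : v ≤ 2 * t := by
        have := Real.rpow_le_rpow_of_exponent_ge (x := 2 * t) (by linarith) (by linarith) hq
        rwa [Real.rpow_one] at this
      have h1 : Real.log (1 / t) = 2 * Real.log 2 + Real.log (1 / (4 * t)) := by
        rw [show (2 : ℝ) * Real.log 2 = Real.log 4 by
          rw [show (4 : ℝ) = 2 ^ 2 by norm_num, Real.log_pow]; norm_num,
          ← Real.log_mul (by norm_num) (by positivity)]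
        congr 1
        field_simp
      have h2 : Real.log (1 / (4 * t)) ≤ 1 / (4 * t) - 1 :=
        Real.log_le_sub_one_of_pos (by positivity)
      calc v * Real.log (1 / t) ≤ 2 * t * Real.log (1 / t) := by gcongr
        _ ≤ 2 * t * (2 * Real.log 2 + (1 / (4 * t) - 1)) := by rw [h1]; gcongr
        _ = t * (4 * Real.log 2 - 2) + 1 / 2 := by field_simp; ring
        _ ≤ Real.log 2 := by nlinarith
    · have hqi : 1 / q ≤ Real.log 2 := by
        rw [div_le_iff₀ hl2] at h
        rw [div_le_iff₀ hq0]
        linarith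
      have h1 : Real.log (1 / t) = Real.log 2 + 1 / q * Real.log (1 / v) := by
        rw [hv, one_div ((2 * t) ^ q), Real.log_inv, Real.log_rpow (by positivity),
          Real.log_mul two_ne_zero ht.ne', one_div t, Real.log_inv]
        field_simp
        ring
      have h2 : Real.log (1 / v) ≤ 1 / v - 1 := Real.log_le_sub_one_of_pos (by positivity)
      have h3 : 0 ≤ Real.log (1 / v) := Real.log_nonneg ((one_le_div hv0).2
        (Real.rpow_le_one (by positivity) (by linarith) hq0.le))
      calc v * Real.log (1 / t) ≤ v * (Real.log 2 + Real.log 2 * (1 / v - 1)) := by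
            rw [h1]
            gcongr
        _ = Real.log 2 := by field_simp; ring
  have heq : 2 * logProfile q t = (v * Real.log (1 / t)) ^ (1 / q) := by
    rw [Real.mul_rpow hv0.le hlogt, hv, ← Real.rpow_mul (by positivity), mul_one_div_cancel hq0.ne',
      Real.rpow_one, logProfile, mul_assoc]
  have heq2 : 2 * logProfile q (1 / 2) = Real.log 2 ^ (1 / q) := by
    rw [logProfile, ← mul_assoc, one_div_one_div]
    norm_num
  have : (v * Real.log (1 / t)) ^ (1 / q) ≤ Real.log 2 ^ (1 / q) := by gcongr
  linarith

end ProfileBounds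

/-! ### The `L¹` inequality -/

section LOne

theorem measureReal_setOf_lt_le_half {E : Type*} [NormedAddCommGroup E] [MeasurableSpace E]
    [BorelSpace E] {μ : Measure E} [IsProbabilityMeasure μ] {F : E → ℝ} (hF : Continuous F) {s : ℝ}
    (hs : 0 ≤ s)
    (h0 : 1 / 2 ≤ μ.real {x | F x = 0}) : μ.real {x | s < F x} ≤ 1 / 2 := by
  have hm : MeasurableSet {x | F x = 0} := (isClosed_singleton.preimage hF).measurableSet
  have h1 := measureReal_mono (μ := μ) (s₁ := {x | s < F x}) (s₂ := {x | F x = 0}ᶜ)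
    (fun x hx => by
      have : s < F x := hx
      exact (hs.trans_lt this).ne')
  rw [probReal_compl_eq_one_sub hm] at h1
  linarith

variable {E : Type*} [NormedAddCommGroup E] [NormedSpace ℝ E] [FiniteDimensional ℝ E]
  [MeasurableSpace E] [BorelSpace E] {μ : Measure E} [IsProbabilityMeasure μ]

theorem ofReal_min_logProfile_le_lintegral_gradNorm {q c₀ : ℝ} (hq : 0 < q) (hc₀ : 0 < c₀)
    (hiso : ∀ A : Set E, MeasurableSet A →
      ENNReal.ofReal (c₀ * logProfile q (minMass μ A)) ≤ minkowskiBoundary μ A)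
    {F : E → ℝ} {t : ℝ} (hF : LocallyLipschitz F) (h01 : ∀ x, 0 ≤ F x ∧ F x ≤ 1) (ht : 0 < t)
    (h1 : t ≤ μ.real {x | F x = 1}) (h0 : 1 / 2 ≤ μ.real {x | F x = 0}) :
    ENNReal.ofReal (c₀ * min (logProfile q t) (logProfile q (1 / 2))) ≤ ∫⁻ x, gradNorm F x ∂μ := by
  have h := lintegral_mul_logProfile_le hiso hF (fun x => (h01 x).1) (fun x => (h01 x).2)
    (w := fun _ => 1) monotone_const continuous_const
  simp only [ENNReal.ofReal_one, one_mul] at h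
  refine le_trans ?_ h
  calc ENNReal.ofReal (c₀ * min (logProfile q t) (logProfile q (1 / 2)))
      = ∫⁻ _ in Set.Ioo (0 : ℝ) 1,
          ENNReal.ofReal (c₀ * min (logProfile q t) (logProfile q (1 / 2))) := by simp
    _ ≤ ∫⁻ s in Set.Ioo (0 : ℝ) 1,
          ENNReal.ofReal (c₀ * logProfile q (minMass μ {x | s < F x})) := by
        refine setLIntegral_mono' measurableSet_Ioo fun s hs => ?_
        have hhalf := measureReal_setOf_lt_le_half hF.continuous hs.1.le h0
        rw [minMass_eq_of_le_half hhalf]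
        gcongr
        refine min_logProfile_le hq ht (h1.trans (measureReal_mono fun x hx => ?_)) hhalf
        have : F x = 1 := hx
        exact hs.2.trans_eq this.symm
    _ ≤ _ := setLIntegral_le_lintegral _ _

end LOne

/-! ### The logarithmic weight -/

section LevelLog

/-- The logarithmic weight `log (max 2 (s^q / b))`. When `∫ G^q ≤ b` and `G` is positive with
probability at most `1/2`, it is a lower bound for `log (1 / μ {G > s})`. -/
noncomputable def levelLog (q b s : ℝ) : ℝ :=
  Real.log (max 2 (s ^ q / b))

variable {q b : ℝ}

theorem half_le_levelLog (s : ℝ) : 1 / 2 ≤ levelLog q b s := by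
  have h1 : Real.log 2 ≤ levelLog q b s := Real.log_le_log two_pos (le_max_left _ _)
  linarith [Real.log_two_gt_d9]

theorem levelLog_nonneg (s : ℝ) : 0 ≤ levelLog q b s := by
  linarith [half_le_levelLog (q := q) (b := b) s]

theorem levelLog_mono (hq : 0 < q) (hb : 0 < b) {s r : ℝ} (hs : 0 ≤ s) (hsr : s ≤ r) :
    levelLog q b s ≤ levelLog q b r := by
  unfold levelLog
  gcongr

theorem continuous_levelLog (hq : 0 < q) : Continuous (levelLog q b) := by
  unfold levelLog
  refine Continuous.log ?_ fun s => (lt_max_of_lt_left two_pos).ne'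
  exact continuous_const.max ((Real.continuous_rpow_const hq.le).div_const _)

/-- The weight is doubling in `s^q`, which makes `∫₀^g s^(q-1) Λ(s) ds` comparable to `g^q Λ(g)`. -/
theorem levelLog_le_two_mul (hb : 0 < b) {s g : ℝ} (h : g ^ q ≤ 2 * s ^ q) (hg : 0 ≤ g) :
    levelLog q b g ≤ 2 * levelLog q b s := by
  unfold levelLog
  have hg0 : 0 ≤ g ^ q := Real.rpow_nonneg hg q
  rw [show (2 : ℝ) * Real.log (max 2 (s ^ q / b)) = Real.log (max 2 (s ^ q / b) ^ 2) by
    rw [Real.log_pow]; norm_num]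
  refine Real.log_le_log (lt_max_of_lt_left two_pos) (max_le ?_ ?_)
  · nlinarith [le_max_left 2 (s ^ q / b)]
  · have h1 : g ^ q / b ≤ 2 * (s ^ q / b) := by
      rw [← mul_div_assoc]; gcongr
    nlinarith [le_max_left 2 (s ^ q / b), le_max_right 2 (s ^ q / b)]

theorem rpow_mul_levelLog_le_integral (hq : 1 ≤ q) (hq2 : q ≤ 2) (hb : 0 < b) {g : ℝ}
    (hg : 0 ≤ g) :
    g ^ q * levelLog q b g / 8 ≤ ∫ s in (0 : ℝ)..g, s ^ (q - 1) * levelLog q b s := by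
  have hq0 : 0 < q := by linarith
  have hcont : Continuous fun s : ℝ => s ^ (q - 1) * levelLog q b s :=
    (Real.continuous_rpow_const (by linarith)).mul (continuous_levelLog hq0)
  -- `a` is chosen so that `a ^ q = g ^ q / 2`
  set a := g * (1 / 2 : ℝ) ^ (1 / q) with ha
  have ha0 : 0 ≤ a := by positivity
  have hag : a ≤ g := mul_le_of_le_one_right hg
    (Real.rpow_le_one (by norm_num) (by norm_num) (by positivity))
  have haq : a ^ q = g ^ q / 2 := by
    rw [ha, Real.mul_rpow hg (by positivity), ← Real.rpow_mul (by norm_num),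
      one_div_mul_cancel hq0.ne', Real.rpow_one]
    ring
  have hgq : 0 ≤ g ^ q := by positivity
  have hΛ := levelLog_nonneg (q := q) (b := b) g
  calc g ^ q * levelLog q b g / 8 ≤ g ^ q * levelLog q b g / (4 * q) := by
        gcongr
        linarith
    _ = ∫ s in a..g, s ^ (q - 1) * (levelLog q b g / 2) := by
        rw [intervalIntegral.integral_mul_const, integral_rpow (Or.inl (by linarith)),
          sub_add_cancel, haq]
        field_simp
        ring
    _ ≤ ∫ s in a..g, s ^ (q - 1) * levelLog q b s := by
        refine intervalIntegral.integral_mono_on hag ?_ (hcont.intervalIntegrable _ _)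
          fun s hs => ?_
        · exact ((Real.continuous_rpow_const (by linarith)).mul
            continuous_const).intervalIntegrable _ _
        · have hs0 : 0 ≤ s := ha0.trans hs.1
          gcongr
          have : a ^ q ≤ s ^ q := by gcongr; exact hs.1
          linarith [levelLog_le_two_mul (s := s) hb (by linarith) hg]
    _ ≤ ∫ s in (0 : ℝ)..g, s ^ (q - 1) * levelLog q b s := by
        rw [← intervalIntegral.integral_add_adjacent_intervals (hcont.intervalIntegrable 0 a)
          (hcont.intervalIntegrable a g)]
        refine le_add_of_nonneg_left (intervalIntegral.integral_nonneg ha0 fun s hs => ?_)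
        exact mul_nonneg (Real.rpow_nonneg hs.1 _) (levelLog_nonneg s)

theorem levelLog_rpow_mul_le_logProfile {s m : ℝ} (hq : 0 < q) (hb : 0 < b)
    (hm0 : 0 ≤ m) (hm : m ≤ 1 / 2) (hsm : s ^ q * m ≤ b) :
    m * levelLog q b s ^ (1 / q) ≤ logProfile q m := by
  rcases hm0.eq_or_lt with rfl | hm0
  · simp [logProfile]
  unfold logProfile
  have : levelLog q b s ≤ Real.log (1 / m) := by
    refine Real.log_le_log (lt_max_of_lt_left two_pos) (max_le ?_ ?_)
    · rw [le_div_iff₀ hm0]; linarith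
    · rw [div_le_div_iff₀ hb hm0]; linarith
  have := levelLog_nonneg (q := q) (b := b) s
  gcongr

end LevelLog

/-! ### Hölder's inequality for lower integrals -/

section Hoelder

/-- Hölder's inequality for the lower Lebesgue integral, with only one measurable factor. -/
theorem lintegral_mul_le_Lp_mul_Lq_of_measurable {α : Type*} [MeasurableSpace α] (μ : Measure α)
    {p q : ℝ} (hpq : p.HolderConjugate q) {h : α → ℝ≥0∞} (hm : Measurable h)
    (hfin : ∀ x, h x ≠ ∞) (f : α → ℝ≥0∞) :
    ∫⁻ x, h x * f x ∂μ ≤ (∫⁻ x, h x ^ p ∂μ) ^ (1 / p) * (∫⁻ x, f x ^ q ∂μ) ^ (1 / q) := by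
  obtain ⟨φ, hφm, hφle, hφ⟩ := exists_measurable_le_lintegral_eq μ fun x => h x * f x
  -- `φ / h` is a measurable minorant of `f` which carries the whole integral of `h * f`
  have hmul : ∀ x, φ x ≤ h x * (φ x / h x) := fun x => by
    by_cases h0 : h x = 0
    · have : φ x ≤ 0 := (hφle x).trans (by simp [h0])
      exact this.trans zero_le
    · rw [ENNReal.mul_div_cancel h0 (hfin x)]
  rw [hφ]
  calc ∫⁻ x, φ x ∂μ ≤ ∫⁻ x, (h * fun y => φ y / h y) x ∂μ := lintegral_mono hmul
    _ ≤ (∫⁻ x, h x ^ p ∂μ) ^ (1 / p) * (∫⁻ x, (φ x / h x) ^ q ∂μ) ^ (1 / q) :=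
        ENNReal.lintegral_mul_le_Lp_mul_Lq μ hpq hm.aemeasurable (hφm.div hm).aemeasurable
    _ ≤ _ := by
        have hp := hpq.pos
        have hq := hpq.symm.pos
        gcongr with x
        exact ENNReal.div_le_of_le_mul' (hφle x)

theorem ENNReal.rpow_mul_le_of_mul_le_rpow_mul_rpow {p q : ℝ} (hpq : p.HolderConjugate q)
    {c a X K : ℝ≥0∞} (hX : X ≠ ∞) (h : c * X ≤ a * (X ^ (1 / p) * K ^ (1 / q))) :
    c ^ q * X ≤ a ^ q * K := by
  have hq := hpq.symm.pos
  have hp := hpq.pos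
  by_cases hX0 : X = 0
  · simp [hX0]
  have hXp0 : X ^ (1 / p) ≠ 0 := by simp [ENNReal.rpow_eq_zero_iff, hX0, hX]
  have hXp : X ^ (1 / p) ≠ ∞ := ENNReal.rpow_ne_top_of_nonneg (by positivity) hX
  have hsplit : X = X ^ (1 / p) * X ^ (1 / q) := by
    rw [← ENNReal.rpow_add _ _ hX0 hX, one_div, one_div, hpq.inv_add_inv_eq_one, ENNReal.rpow_one]
  have h1 : X ^ (1 / p) * (c * X ^ (1 / q)) ≤ X ^ (1 / p) * (a * K ^ (1 / q)) := by
    calc _ = c * X := by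
            conv_rhs => rw [hsplit]
            ring
      _ ≤ _ := h
      _ = _ := by ring
  have h2 : c * X ^ (1 / q) ≤ a * K ^ (1 / q) := (ENNReal.mul_le_mul_iff_right hXp0 hXp).1 h1
  have h3 := ENNReal.rpow_le_rpow h2 hq.le
  rwa [ENNReal.mul_rpow_of_nonneg _ _ hq.le, ENNReal.mul_rpow_of_nonneg _ _ hq.le,
    ← ENNReal.rpow_mul, ← ENNReal.rpow_mul, one_div_mul_cancel hq.ne', ENNReal.rpow_one,
    ENNReal.rpow_one] at h3

end Hoelder

/-! ### The central estimate for functions vanishing with probability one half -/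

section HalfSpace

variable {E : Type*} [NormedAddCommGroup E] [NormedSpace ℝ E] [FiniteDimensional ℝ E]
  [MeasurableSpace E] [BorelSpace E] {μ : Measure E} [IsProbabilityMeasure μ]

theorem rpow_mul_measureReal_lt_le {α : Type*} [MeasurableSpace α] {μ : Measure α}
    [IsProbabilityMeasure μ] {G : α → ℝ} (hG : Measurable G) {q b s : ℝ} (hq : 0 < q)
    (hb : 0 ≤ b) (hs : 0 ≤ s) (hGb : ∫⁻ x, ENNReal.ofReal (G x ^ q) ∂μ ≤ ENNReal.ofReal b) :
    s ^ q * μ.real {x | s < G x} ≤ b := by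
  have h1 := mul_meas_ge_le_lintegral (μ := μ) (hG.pow_const q).ennreal_ofReal
    (ENNReal.ofReal (s ^ q))
  have h2 : μ {x | s < G x} ≤ μ {x | ENNReal.ofReal (s ^ q) ≤ ENNReal.ofReal (G x ^ q)} :=
    measure_mono fun x hx => ENNReal.ofReal_le_ofReal
      (Real.rpow_le_rpow hs (le_of_lt (Set.mem_ofPred.1 hx)) hq.le)
  have h3 : ENNReal.ofReal (s ^ q * μ.real {x | s < G x}) ≤ ENNReal.ofReal b := by
    rw [ENNReal.ofReal_mul (by positivity), ofReal_measureReal]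
    exact ((mul_le_mul_right h2 _).trans h1).trans hGb
  exact (ENNReal.ofReal_le_ofReal_iff hb).1 h3

variable {p q c₀ : ℝ}

/-- The central estimate, for bounded functions. The coarea inequality is used with the weight
`w(s) = s^(q-1) Λ(s)^(1/p)`, where `Λ = levelLog q b`. By Markov's inequality the profile of
`m = μ {G > s}` is at least `m Λ(s)^(1/q)`, so the lower side becomes `∫ s^(q-1) Λ(s) m ds`, which
is comparable to `∫ G^q Λ(G) dμ`. Hölder's inequality bounds the upper side by
`(∫ G^q Λ(G))^(1/p) (∫ ‖∇G‖^q)^(1/q)`. -/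
theorem rpow_mul_lintegral_levelLog_le_of_bounded (hpq : p.HolderConjugate q) (hq2 : q ≤ 2)
    (hc₀ : 0 < c₀) (hiso : ∀ A : Set E, MeasurableSet A →
      ENNReal.ofReal (c₀ * logProfile q (minMass μ A)) ≤ minkowskiBoundary μ A)
    {G : E → ℝ} (hG : LocallyLipschitz G) (h0 : ∀ x, 0 ≤ G x) {N : ℝ} (hN : ∀ x, G x ≤ N)
    (hhalf : μ.real {x | 0 < G x} ≤ 1 / 2) {b : ℝ} (hb : 0 < b)
    (hGb : ∫⁻ x, ENNReal.ofReal (G x ^ q) ∂μ ≤ ENNReal.ofReal b) :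
    ENNReal.ofReal (c₀ ^ q) * ∫⁻ x, ENNReal.ofReal (G x ^ q * levelLog q b (G x)) ∂μ
      ≤ 64 * ∫⁻ x, gradNorm G x ^ q ∂μ := by
  have hq1 : 1 < q := hpq.symm.lt
  have hq : 0 < q := by linarith
  have hp : 0 < p := hpq.pos
  have hGm : Measurable G := hG.continuous.measurable
  have hΛ : Continuous (levelLog q b) := continuous_levelLog hq
  set w : ℝ → ℝ := fun s => max s 0 ^ (q - 1) * levelLog q b (max s 0) ^ (1 / p) with hw
  have hwc : Continuous w :=
    ((Real.continuous_rpow_const (by linarith)).comp (continuous_id.max continuous_const)).mul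
      ((Real.continuous_rpow_const (by positivity)).comp
        (hΛ.comp (continuous_id.max continuous_const)))
  have hwm : Monotone w := fun s t hst => by
    have h1 : max s 0 ≤ max t 0 := max_le_max_right _ hst
    have h2 := levelLog_mono hq hb (le_max_right s 0) h1
    have h3 := levelLog_nonneg (q := q) (b := b) (max s 0)
    have h4 : (0 : ℝ) ≤ max s 0 := le_max_right _ _
    have h5 : 0 ≤ q - 1 := by linarith
    have h6 : (0 : ℝ) ≤ max t 0 := le_max_right _ _
    simp only [hw]
    gcongr
  have hw0 : ∀ s, 0 ≤ w s := fun s => mul_nonneg (Real.rpow_nonneg (le_max_right _ _) _)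
    (Real.rpow_nonneg (levelLog_nonneg _) _)
  set X := ∫⁻ x, ENNReal.ofReal (G x ^ q * levelLog q b (G x)) ∂μ with hX
  set K := ∫⁻ x, gradNorm G x ^ q ∂μ with hK
  have hXfin : X ≠ ∞ := by
    refine ne_top_of_le_ne_top (b := ENNReal.ofReal (N ^ q * levelLog q b N))
      ENNReal.ofReal_ne_top ?_
    refine (lintegral_mono fun x => ENNReal.ofReal_le_ofReal
      (mul_le_mul (Real.rpow_le_rpow (h0 x) (hN x) hq.le) (levelLog_mono hq hb (h0 x) (hN x))
        (levelLog_nonneg _) (Real.rpow_nonneg ((h0 x).trans (hN x)) _))).trans ?_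
    simp
  have hlayer : X ≤ 8 * ∫⁻ s in Set.Ioi (0 : ℝ),
      μ {x | s < G x} * ENNReal.ofReal (s ^ (q - 1) * levelLog q b s) := by
    have hcont : Continuous fun s : ℝ => s ^ (q - 1) * levelLog q b s :=
      (Real.continuous_rpow_const (by linarith)).mul hΛ
    rw [← lintegral_comp_eq_lintegral_meas_lt_mul μ (Eventually.of_forall h0) hGm.aemeasurable
      (fun t _ => hcont.intervalIntegrable _ _)
      ((ae_restrict_mem measurableSet_Ioi).mono fun s hs =>
        mul_nonneg (Real.rpow_nonneg (le_of_lt hs) _) (levelLog_nonneg s)),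
      ← lintegral_const_mul' _ _ (by norm_num)]
    refine lintegral_mono fun x => ?_
    rw [show (8 : ℝ≥0∞) = ENNReal.ofReal 8 by norm_num, ← ENNReal.ofReal_mul (by norm_num)]
    refine ENNReal.ofReal_le_ofReal ?_
    linarith [rpow_mul_levelLog_le_integral hq1.le hq2 hb (h0 x)]
  have hcoarea : ENNReal.ofReal c₀ * ∫⁻ s in Set.Ioi (0 : ℝ),
      μ {x | s < G x} * ENNReal.ofReal (s ^ (q - 1) * levelLog q b s)
      ≤ ∫⁻ x, ENNReal.ofReal (w (G x)) * gradNorm G x ∂μ := by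
    refine le_trans ?_ (lintegral_mul_logProfile_le hiso hG h0 hN hwm hwc)
    refine le_trans ?_ (setLIntegral_le_lintegral (Set.Ioi (0 : ℝ)) _)
    rw [← lintegral_const_mul' _ _ ENNReal.ofReal_ne_top]
    refine setLIntegral_mono' measurableSet_Ioi fun s hs => ?_
    have hs0 : (0 : ℝ) < s := hs
    have hmhalf : μ.real {x | s < G x} ≤ 1 / 2 :=
      (measureReal_mono (s₂ := {x | 0 < G x}) fun x hx => hs0.trans hx).trans hhalf
    rw [minMass_eq_of_le_half hmhalf, ← ofReal_measureReal (μ := μ) (s := {x | s < G x}),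
      ← ENNReal.ofReal_mul measureReal_nonneg, ← ENNReal.ofReal_mul hc₀.le,
      ← ENNReal.ofReal_mul (hw0 s)]
    refine ENNReal.ofReal_le_ofReal ?_
    have hprof := levelLog_rpow_mul_le_logProfile hq hb measureReal_nonneg hmhalf
      (rpow_mul_measureReal_lt_le hGm hq hb.le hs0.le hGb)
    have hΛs := half_le_levelLog (q := q) (b := b) s
    have hsplit : levelLog q b s = levelLog q b s ^ (1 / p) * levelLog q b s ^ (1 / q) := by
      rw [← Real.rpow_add (by linarith), one_div, one_div, hpq.inv_add_inv_eq_one, Real.rpow_one]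
    calc c₀ * (μ.real {x | s < G x} * (s ^ (q - 1) * levelLog q b s))
        = s ^ (q - 1) * levelLog q b s ^ (1 / p) *
          (c₀ * (μ.real {x | s < G x} * levelLog q b s ^ (1 / q))) := by
          conv_lhs => rw [hsplit]
          ring
      _ ≤ s ^ (q - 1) * levelLog q b s ^ (1 / p) *
          (c₀ * logProfile q (μ.real {x | s < G x})) := by
          have : 0 ≤ levelLog q b s ^ (1 / p) := Real.rpow_nonneg (by linarith) _
          gcongr
      _ = w s * (c₀ * logProfile q (μ.real {x | s < G x})) := by
          simp only [hw, max_eq_left hs0.le]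
  have hHoelder : ∫⁻ x, ENNReal.ofReal (w (G x)) * gradNorm G x ∂μ ≤ X ^ (1 / p) * K ^ (1 / q) := by
    refine (lintegral_mul_le_Lp_mul_Lq_of_measurable μ hpq
      (hwc.measurable.comp hGm).ennreal_ofReal (fun _ => ENNReal.ofReal_ne_top) _).trans_eq ?_
    congr 3
    ext x
    have h1 := levelLog_nonneg (q := q) (b := b) (G x)
    have h2 := h0 x
    rw [Function.comp_apply, ENNReal.ofReal_rpow_of_nonneg (hw0 _) hp.le]
    simp only [hw, max_eq_left h2]
    rw [Real.mul_rpow (by positivity) (by positivity), ← Real.rpow_mul h2, ← Real.rpow_mul h1,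
      one_div_mul_cancel hp.ne', Real.rpow_one, hpq.symm.sub_one_mul_conj]
  have hmain : ENNReal.ofReal c₀ * X ≤ 8 * (X ^ (1 / p) * K ^ (1 / q)) :=
    calc ENNReal.ofReal c₀ * X ≤ ENNReal.ofReal c₀ * (8 * ∫⁻ s in Set.Ioi (0 : ℝ),
          μ {x | s < G x} * ENNReal.ofReal (s ^ (q - 1) * levelLog q b s)) := by gcongr
      _ = 8 * (ENNReal.ofReal c₀ * ∫⁻ s in Set.Ioi (0 : ℝ),
          μ {x | s < G x} * ENNReal.ofReal (s ^ (q - 1) * levelLog q b s)) := by ring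
      _ ≤ _ := mul_le_mul_right (hcoarea.trans hHoelder) 8
  rw [← ENNReal.ofReal_rpow_of_pos hc₀]
  refine (ENNReal.rpow_mul_le_of_mul_le_rpow_mul_rpow hpq hXfin hmain).trans ?_
  gcongr
  calc (8 : ℝ≥0∞) ^ q ≤ 8 ^ (2 : ℝ) := ENNReal.rpow_le_rpow_of_exponent_le (by norm_num) hq2
    _ = 64 := by
      rw [ENNReal.rpow_ofNat]; norm_num

/-- The central estimate without boundedness and with an explicit admissible choice of `b`. A first
application to the truncations of `G`, using only `levelLog ≥ 1/2`, is a Poincaré inequality which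
shows that every `b` with `128 ∫ ‖∇G‖^q ≤ c₀^q b` dominates `∫ G^q`. -/
theorem rpow_mul_lintegral_levelLog_le (hpq : p.HolderConjugate q) (hq2 : q ≤ 2)
    (hc₀ : 0 < c₀) (hiso : ∀ A : Set E, MeasurableSet A →
      ENNReal.ofReal (c₀ * logProfile q (minMass μ A)) ≤ minkowskiBoundary μ A)
    {G : E → ℝ} (hG : LocallyLipschitz G) (h0 : ∀ x, 0 ≤ G x)
    (hhalf : μ.real {x | 0 < G x} ≤ 1 / 2) {b : ℝ} (hb : 0 < b)
    (hGb : 128 * ∫⁻ x, gradNorm G x ^ q ∂μ ≤ ENNReal.ofReal (c₀ ^ q) * ENNReal.ofReal b) :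
    ENNReal.ofReal (c₀ ^ q) * ∫⁻ x, ENNReal.ofReal (G x ^ q * levelLog q b (G x)) ∂μ
      ≤ 64 * ∫⁻ x, gradNorm G x ^ q ∂μ := by
  have hq : 0 < q := hpq.symm.pos
  have hcq0 : ENNReal.ofReal (c₀ ^ q) ≠ 0 := (ENNReal.ofReal_pos.2 (by positivity)).ne'
  set T : ℕ → E → ℝ := fun n x => min (G x) n with hT
  have hTlip : ∀ n, LocallyLipschitz (T n) := fun n => hG.min_const _
  have hT0 : ∀ n x, 0 ≤ T n x := fun n x => le_min (h0 x) (Nat.cast_nonneg n)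
  have hTn : ∀ n x, T n x ≤ n := fun n x => min_le_right _ _
  have hThalf : ∀ n, μ.real {x | 0 < T n x} ≤ 1 / 2 := fun n =>
    (measureReal_mono fun x hx => (Set.mem_ofPred.1 hx).trans_le (min_le_left _ _)).trans hhalf
  have hTgrad : ∀ n, ∫⁻ x, gradNorm (T n) x ^ q ∂μ ≤ ∫⁻ x, gradNorm G x ^ q ∂μ := fun n => by
    gcongr with x
    refine gradNorm_le_of_abs_sub_le (fun x y => ?_) x
    refine (abs_min_sub_min_le_max _ _ _ _).trans (max_le le_rfl ?_)
    simp
  have hTb : ∀ n, ∫⁻ x, ENNReal.ofReal (T n x ^ q) ∂μ ≤ ENNReal.ofReal b := fun n => by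
    have hbn : (0 : ℝ) < (n : ℝ) ^ q + 1 := by positivity
    have h1 := rpow_mul_lintegral_levelLog_le_of_bounded hpq hq2 hc₀ hiso (hTlip n) (hT0 n) (hTn n)
      (hThalf n) hbn (by
        calc ∫⁻ x, ENNReal.ofReal (T n x ^ q) ∂μ ≤ ∫⁻ _, ENNReal.ofReal ((n : ℝ) ^ q + 1) ∂μ :=
              lintegral_mono fun x => ENNReal.ofReal_le_ofReal
                ((Real.rpow_le_rpow (hT0 n x) (hTn n x) hq.le).trans (by linarith))
          _ = _ := by simp)
    have h2 : ∫⁻ x, ENNReal.ofReal (T n x ^ q) ∂μ ≤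
        2 * ∫⁻ x, ENNReal.ofReal (T n x ^ q * levelLog q ((n : ℝ) ^ q + 1) (T n x)) ∂μ := by
      rw [← lintegral_const_mul' _ _ (by norm_num)]
      refine lintegral_mono fun x => ?_
      rw [show (2 : ℝ≥0∞) = ENNReal.ofReal 2 by norm_num, ← ENNReal.ofReal_mul (by norm_num)]
      refine ENNReal.ofReal_le_ofReal ?_
      have h3 := half_le_levelLog (q := q) (b := (n : ℝ) ^ q + 1) (T n x)
      have h4 := Real.rpow_nonneg (hT0 n x) q
      nlinarith
    have h3 : ENNReal.ofReal (c₀ ^ q) * ∫⁻ x, ENNReal.ofReal (T n x ^ q) ∂μ ≤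
        ENNReal.ofReal (c₀ ^ q) * ENNReal.ofReal b :=
      calc _ ≤ ENNReal.ofReal (c₀ ^ q) * (2 * ∫⁻ x, ENNReal.ofReal
            (T n x ^ q * levelLog q ((n : ℝ) ^ q + 1) (T n x)) ∂μ) := by gcongr
        _ = 2 * (ENNReal.ofReal (c₀ ^ q) * ∫⁻ x, ENNReal.ofReal
            (T n x ^ q * levelLog q ((n : ℝ) ^ q + 1) (T n x)) ∂μ) := by ring
        _ ≤ 2 * (64 * ∫⁻ x, gradNorm G x ^ q ∂μ) :=
            mul_le_mul_right (h1.trans (mul_le_mul_right (hTgrad n) 64)) 2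
        _ = 128 * ∫⁻ x, gradNorm G x ^ q ∂μ := by rw [← mul_assoc]; norm_num
        _ ≤ _ := hGb
    exact (ENNReal.mul_le_mul_iff_right hcq0 ENNReal.ofReal_ne_top).1 h3
  have hTmain : ∀ n, ENNReal.ofReal (c₀ ^ q) *
      ∫⁻ x, ENNReal.ofReal (T n x ^ q * levelLog q b (T n x)) ∂μ
      ≤ 64 * ∫⁻ x, gradNorm G x ^ q ∂μ := fun n =>
    (rpow_mul_lintegral_levelLog_le_of_bounded hpq hq2 hc₀ hiso (hTlip n) (hT0 n) (hTn n)
      (hThalf n) hb (hTb n)).trans (mul_le_mul_right (hTgrad n) 64)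
  have hmeas : ∀ n, Measurable fun x => ENNReal.ofReal (T n x ^ q * levelLog q b (T n x)) :=
    fun n => (((hTlip n).continuous.measurable.pow_const q).mul
      ((continuous_levelLog hq).measurable.comp (hTlip n).continuous.measurable)).ennreal_ofReal
  calc ENNReal.ofReal (c₀ ^ q) * ∫⁻ x, ENNReal.ofReal (G x ^ q * levelLog q b (G x)) ∂μ
      ≤ ENNReal.ofReal (c₀ ^ q) * ∫⁻ x, liminf (fun n =>
          ENNReal.ofReal (T n x ^ q * levelLog q b (T n x))) atTop ∂μ := by
        gcongr with x
        refine le_liminf_of_le (by isBoundedDefault) ?_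
        filter_upwards [eventually_ge_atTop ⌈G x⌉₊] with n hn
        simp only [hT, min_eq_left (Nat.ceil_le.1 hn), le_refl]
    _ ≤ ENNReal.ofReal (c₀ ^ q) * liminf (fun n =>
          ∫⁻ x, ENNReal.ofReal (T n x ^ q * levelLog q b (T n x)) ∂μ) atTop := by
        gcongr
        exact lintegral_liminf_le hmeas
    _ = liminf (fun n => ENNReal.ofReal (c₀ ^ q) *
          ∫⁻ x, ENNReal.ofReal (T n x ^ q * levelLog q b (T n x)) ∂μ) atTop :=
        (ENNReal.liminf_const_mul_of_ne_top ENNReal.ofReal_ne_top).symm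
    _ ≤ 64 * ∫⁻ x, gradNorm G x ^ q ∂μ :=
        liminf_le_of_le (by isBoundedDefault) fun a ha => by
          obtain ⟨n, hn⟩ := ha.exists
          exact hn.trans (hTmain n)

end HalfSpace

/-! ### Entropy -/

section Entropy

/-- The nonnegativity of `x log (x / a) - x + a`, which is the relative entropy density. -/
theorem sub_le_mul_log_div {x a : ℝ} (hx : 0 ≤ x) (ha : 0 < a) : x - a ≤ x * Real.log (x / a) := by
  rcases hx.eq_or_lt with rfl | hx
  · simpa using ha.le
  have h := Real.one_sub_inv_le_log_of_pos (div_pos hx ha)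
  calc x - a = x * (1 - (x / a)⁻¹) := by field_simp
    _ ≤ _ := by gcongr

theorem abs_rpow_sub_one_le {q u : ℝ} (hq : 1 ≤ q) (hq2 : q ≤ 2) (hu0 : 0 ≤ u) (hu2 : u ≤ 2) :
    |u ^ q - 1| ≤ 3 * |u - 1| := by
  rcases le_total u 1 with h | h
  · have h1 : u ^ q ≤ 1 := Real.rpow_le_one hu0 h (by linarith)
    have h2 : u ^ 2 ≤ u ^ q := by
      rcases hu0.eq_or_lt with rfl | hu
      · simpa using Real.rpow_nonneg le_rfl q
      · have := Real.rpow_le_rpow_of_exponent_ge hu h hq2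
        rwa [Real.rpow_two] at this
    rw [abs_of_nonpos (by linarith), abs_of_nonpos (by linarith)]
    nlinarith
  · have h1 : 1 ≤ u ^ q := Real.one_le_rpow h (by linarith)
    have h2 : u ^ q ≤ u ^ 2 := by
      have := Real.rpow_le_rpow_of_exponent_le h hq2
      rwa [Real.rpow_two] at this
    rw [abs_of_nonneg (by linarith), abs_of_nonneg (by linarith)]
    nlinarith

theorem add_rpow_le_four_mul {q x y : ℝ} (hq : 0 ≤ q) (hq2 : q ≤ 2) (hx : 0 ≤ x) (hy : 0 ≤ y) :
    (x + y) ^ q ≤ 4 * (x ^ q + y ^ q) := by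
  have h4 : (2 : ℝ) ^ q ≤ 4 := by
    have := Real.rpow_le_rpow_of_exponent_le (one_le_two (α := ℝ)) hq2
    rw [Real.rpow_two] at this
    linarith
  have hxq := Real.rpow_nonneg hx q
  have hyq := Real.rpow_nonneg hy q
  have key : ∀ z : ℝ, 0 ≤ z → x + y ≤ 2 * z → (x + y) ^ q ≤ 4 * z ^ q := fun z hz h =>
    calc (x + y) ^ q ≤ (2 * z) ^ q := by gcongr
      _ = 2 ^ q * z ^ q := Real.mul_rpow two_pos.le hz
      _ ≤ 4 * z ^ q := by gcongr
  rcases le_total x y with h | h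
  · linarith [key y hy (by linarith)]
  · linarith [key x hx (by linarith)]

/-- A pointwise form of Rothaus' recentring lemma: the relative entropy density of `f^q` with
respect to the constant `(m + b^(1/q))^q` is controlled by the distance of `f` to `m`. Near the
constant the density is quadratic; far from it, `f` is comparable to `f - m`. Adding
`b^(1/q)` keeps the constant positive when `m = 0`. -/
theorem rpow_mul_log_sub_add_le {q b f m : ℝ} (hq : 1 ≤ q) (hq2 : q ≤ 2) (hb : 0 < b)
    (hf : 0 ≤ f) (hm : 0 ≤ m) :
    f ^ q * Real.log (f ^ q / (m + b ^ (1 / q)) ^ q) - f ^ q + (m + b ^ (1 / q)) ^ q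
      ≤ 84 * (|f - m| ^ q * levelLog q b |f - m|) + 36 * b := by
  have hq0 : 0 < q := by linarith
  set β := b ^ (1 / q) with hβ
  have hβ0 : 0 < β := by positivity
  have hβq : β ^ q = b := by
    rw [hβ, ← Real.rpow_mul hb.le, one_div_mul_cancel hq0.ne', Real.rpow_one]
  set A := m + β with hA
  have hA0 : 0 < A := by positivity
  have hAq : 0 < A ^ q := by positivity
  have hfq : 0 ≤ f ^ q := by positivity
  set D := |f - m| with hD
  have hD0 : 0 ≤ D := abs_nonneg _
  have hDq : 0 ≤ D ^ q := by positivity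
  have hΛ := half_le_levelLog (q := q) (b := b) D
  have hDΛ : D ^ q ≤ 2 * (D ^ q * levelLog q b D) := by nlinarith
  rcases le_total f (2 * A) with h | h
  · -- with `u = f / A` the density is at most `A^q (u^q - 1)^2 ≤ 9 A^q |u - 1|^q`
    set u := f / A with hu
    have hu0 : 0 ≤ u := by positivity
    have hu2 : u ≤ 2 := by rw [hu, div_le_iff₀ hA0]; exact h
    have hfu : f = A * u := by rw [hu]; field_simp
    have hfuq : f ^ q = A ^ q * u ^ q := by rw [hfu, Real.mul_rpow hA0.le hu0]
    have h1 : f ^ q * Real.log (f ^ q / A ^ q) - f ^ q + A ^ q ≤ A ^ q * (u ^ q - 1) ^ 2 := by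
      have huq : 0 ≤ u ^ q := by positivity
      have h2 : f ^ q / A ^ q = u ^ q := by rw [hfuq]; field_simp
      have h3 : u ^ q * Real.log (u ^ q) ≤ u ^ q * (u ^ q - 1) := by
        rcases huq.eq_or_lt with h0 | h0
        · simp [← h0]
        · exact mul_le_mul_of_nonneg_left (Real.log_le_sub_one_of_pos h0) huq
      rw [h2, hfuq]
      nlinarith
    have h2 : (u ^ q - 1) ^ 2 ≤ 9 * |u - 1| ^ q := by
      have h3 := abs_rpow_sub_one_le hq hq2 hu0 hu2
      have h4 : |u - 1| ≤ 1 := abs_le.2 ⟨by linarith, by linarith⟩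
      have h5 : |u - 1| ^ 2 ≤ |u - 1| ^ q := by
        rcases (abs_nonneg (u - 1)).eq_or_lt with h0 | h0
        · rw [← h0, Real.zero_rpow hq0.ne']; norm_num
        · have := Real.rpow_le_rpow_of_exponent_ge h0 h4 hq2
          rwa [Real.rpow_two] at this
      rw [← sq_abs]
      nlinarith [abs_nonneg (u ^ q - 1), abs_nonneg (u - 1)]
    have h3 : A ^ q * |u - 1| ^ q ≤ 4 * (D ^ q + b) := by
      rw [← Real.mul_rpow hA0.le (abs_nonneg _), ← hβq]
      refine le_trans ?_ (add_rpow_le_four_mul hq0.le hq2 hD0 hβ0.le)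
      have h4 : A * |u - 1| = |f - m - β| := by
        rw [← abs_of_pos hA0, ← abs_mul, mul_sub, ← hfu, mul_one, hA, sub_sub]
      rw [h4]
      gcongr
      refine (abs_sub _ _).trans ?_
      rw [abs_of_pos hβ0]
    nlinarith [mul_le_mul_of_nonneg_left h2 hAq.le]
  · have hfD : f ≤ 2 * D := by
      have := le_abs_self (f - m)
      linarith
    have hβD : β ≤ D := by
      have := le_abs_self (f - m)
      linarith
    have hR : 1 ≤ D ^ q / b := by
      rw [one_le_div hb, ← hβq]
      gcongr
    have h4 : f ^ q ≤ 4 * D ^ q := by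
      have := add_rpow_le_four_mul hq0.le hq2 hD0 le_rfl
      rw [add_zero, Real.zero_rpow hq0.ne'] at this
      calc f ^ q ≤ (2 * D) ^ q := by gcongr
        _ = 2 ^ q * D ^ q := Real.mul_rpow two_pos.le hD0
        _ ≤ 4 * D ^ q := by
          gcongr
          have := Real.rpow_le_rpow_of_exponent_le (one_le_two (α := ℝ)) hq2
          rw [Real.rpow_two] at this
          linarith
    have hAf : A ^ q ≤ f ^ q := by
      gcongr
      linarith
    have hbA : b ≤ A ^ q := by
      rw [← hβq]
      gcongr
      linarith
    have hlog : Real.log (f ^ q / A ^ q) ≤ 3 * levelLog q b D := by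
      unfold levelLog
      rw [show (3 : ℝ) * Real.log (max 2 (D ^ q / b)) = Real.log (max 2 (D ^ q / b) ^ 3) by
        rw [Real.log_pow]; norm_num]
      refine Real.log_le_log (div_pos (hAq.trans_le hAf) hAq) ?_
      calc f ^ q / A ^ q ≤ 4 * D ^ q / b := by gcongr
        _ = 4 * (D ^ q / b) := by ring
        _ ≤ max 2 (D ^ q / b) ^ 3 := by
          have h5 := le_max_left 2 (D ^ q / b)
          have h6 := le_max_right 2 (D ^ q / b)
          nlinarith [mul_le_mul h5 h5 (by norm_num) (by linarith)]
    have hlog0 : 0 ≤ Real.log (f ^ q / A ^ q) := Real.log_nonneg ((one_le_div hAq).2 hAf)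
    have h5 : f ^ q * Real.log (f ^ q / A ^ q) ≤ 4 * D ^ q * (3 * levelLog q b D) :=
      mul_le_mul h4 hlog hlog0 (by positivity)
    nlinarith

/-- Integrated recentring: a bound on the logarithmic moments of `|F - m|` bounds the entropy of
`F^q`, by the variational formula
`Ent g = inf_a ∫ (g log (g / a) - g + a)` with `a = (m + b^(1/q))^q`. -/
theorem integrable_and_entropy_le {α : Type*} [MeasurableSpace α] {μ : Measure α}
    [IsProbabilityMeasure μ] {F : α → ℝ} (hF : Measurable F) (h0 : ∀ x, 0 ≤ F x) {q m κ : ℝ}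
    (hq : 1 ≤ q) (hq2 : q ≤ 2) (hm : 0 ≤ m) (hκ : 0 ≤ κ)
    (h : ∀ b, κ < b → ∫⁻ x, ENNReal.ofReal (|F x - m| ^ q * levelLog q b |F x - m|) ∂μ
      ≤ ENNReal.ofReal κ) :
    Integrable (fun x => F x ^ q) μ ∧
      Integrable (fun x => F x ^ q * Real.log (F x ^ q / ∫ y, F y ^ q ∂μ)) μ ∧
      ∫ x, F x ^ q * Real.log (F x ^ q / ∫ y, F y ^ q ∂μ) ∂μ ≤ 120 * κ := by
  have hq0 : 0 < q := by linarith
  have hFq : Measurable fun x => F x ^ q := hF.pow_const q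
  have hDm : Measurable fun x => |F x - m| := (hF.sub_const m).norm
  have hU0 : ∀ b x, 0 ≤ |F x - m| ^ q * levelLog q b |F x - m| := fun b x =>
    mul_nonneg (Real.rpow_nonneg (abs_nonneg _) _) (levelLog_nonneg _)
  have hUm : ∀ b, Measurable fun x => |F x - m| ^ q * levelLog q b |F x - m| := fun b =>
    (hDm.pow_const q).mul ((continuous_levelLog hq0).measurable.comp hDm)
  have hUint : ∀ b, κ < b → Integrable (fun x => |F x - m| ^ q * levelLog q b |F x - m|) μ :=
    fun b hb => (lintegral_ofReal_ne_top_iff_integrable (hUm b).aestronglyMeasurable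
      (Eventually.of_forall (hU0 b))).1 (ne_top_of_le_ne_top ENNReal.ofReal_ne_top (h b hb))
  have hUle : ∀ b, κ < b → ∫ x, |F x - m| ^ q * levelLog q b |F x - m| ∂μ ≤ κ := fun b hb => by
    rw [integral_eq_lintegral_of_nonneg_ae (Eventually.of_forall (hU0 b))
      (hUm b).aestronglyMeasurable]
    exact ENNReal.toReal_le_of_le_ofReal hκ (h b hb)
  have hint : Integrable (fun x => F x ^ q) μ := by
    refine (((hUint (κ + 1) (by linarith)).const_mul 8).add (integrable_const (4 * m ^ q))).mono'
      hFq.aestronglyMeasurable (Eventually.of_forall fun x => ?_)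
    rw [Real.norm_of_nonneg (Real.rpow_nonneg (h0 x) q), Pi.add_apply]
    have h1 := half_le_levelLog (q := q) (b := κ + 1) |F x - m|
    have h2 : 0 ≤ |F x - m| ^ q := Real.rpow_nonneg (abs_nonneg _) _
    have h3 : F x ^ q ≤ (|F x - m| + m) ^ q :=
      Real.rpow_le_rpow (h0 x) (by linarith [le_abs_self (F x - m)]) hq0.le
    nlinarith [add_rpow_le_four_mul hq0.le hq2 (abs_nonneg (F x - m)) hm]
  refine ⟨hint, ?_⟩
  set M := ∫ y, F y ^ q ∂μ with hM
  have hM0 : 0 ≤ M := integral_nonneg fun x => Real.rpow_nonneg (h0 x) q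
  -- if `∫ F^q = 0`, the integrand is `F^q * log 0 = 0` by the conventions for `/` and `log`
  rcases hM0.eq_or_lt with hMz | hMpos
  · simp only [← hMz, div_zero, Real.log_zero, mul_zero, integral_zero]
    exact ⟨integrable_zero _ _ _, by positivity⟩
  have main : ∀ b, κ < b → Integrable (fun x => F x ^ q * Real.log (F x ^ q / M)) μ ∧
      ∫ x, F x ^ q * Real.log (F x ^ q / M) ∂μ ≤ 84 * κ + 36 * b := by
    intro b hb
    have hb0 : 0 < b := hκ.trans_lt hb
    set a := (m + b ^ (1 / q)) ^ q with ha
    have ha0 : 0 < a := by positivity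
    set V : α → ℝ := fun x => F x ^ q * Real.log (F x ^ q / a) - F x ^ q + a with hV
    have hV0 : ∀ x, 0 ≤ V x := fun x => by
      have := sub_le_mul_log_div (Real.rpow_nonneg (h0 x) q) ha0
      simp only [hV]
      linarith
    have hVle : ∀ x, V x ≤ 84 * (|F x - m| ^ q * levelLog q b |F x - m|) + 36 * b := fun x =>
      rpow_mul_log_sub_add_le hq hq2 hb0 (h0 x) hm
    have hbound : Integrable
        (fun x => 84 * (|F x - m| ^ q * levelLog q b |F x - m|) + 36 * b) μ :=
      ((hUint b hb).const_mul 84).add (integrable_const _)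
    have hVm : Measurable V :=
      ((hFq.mul (hFq.div_const a).log).sub hFq).add_const a
    have hVint : Integrable V μ := hbound.mono' hVm.aestronglyMeasurable
      (Eventually.of_forall fun x => by rw [Real.norm_of_nonneg (hV0 x)]; exact hVle x)
    have hVI : ∫ x, V x ∂μ ≤ 84 * κ + 36 * b := by
      refine (integral_mono hVint hbound hVle).trans ?_
      rw [integral_add ((hUint b hb).const_mul 84) (integrable_const _), integral_const_mul]
      simp only [integral_const, probReal_univ, one_smul]
      linarith [hUle b hb]
    have hdecomp : (fun x => F x ^ q * Real.log (F x ^ q / M)) =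
        fun x => V x + (F x ^ q * (1 + Real.log (a / M)) - a) := by
      ext x
      simp only [hV]
      rcases (Real.rpow_nonneg (h0 x) q).eq_or_lt with hz | hpos
      · simp [← hz]
      · rw [Real.log_div hpos.ne' hMpos.ne', Real.log_div hpos.ne' ha0.ne',
          Real.log_div ha0.ne' hMpos.ne']
        ring
    have hrest : Integrable (fun x => F x ^ q * (1 + Real.log (a / M)) - a) μ :=
      (hint.mul_const _).sub (integrable_const _)
    rw [hdecomp]
    refine ⟨hVint.add hrest, ?_⟩
    rw [integral_add hVint hrest, integral_sub (hint.mul_const _) (integrable_const _),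
      integral_mul_const, ← hM]
    simp only [integral_const, probReal_univ, one_smul]
    have hlog : M * Real.log (a / M) ≤ a - M :=
      calc M * Real.log (a / M) ≤ M * (a / M - 1) := by
            gcongr
            exact Real.log_le_sub_one_of_pos (div_pos ha0 hMpos)
        _ = a - M := by field_simp
    linarith
  refine ⟨(main (κ + 1) (by linarith)).1, le_of_forall_pos_le_add fun η hη => ?_⟩
  have := (main (κ + η / 36) (by linarith [div_pos hη (show (0 : ℝ) < 36 by norm_num)])).2
  linarith

theorem exists_median {α : Type*} [MeasurableSpace α] {μ : Measure α} [IsProbabilityMeasure μ]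
    {F : α → ℝ} (hF : Measurable F) (h0 : ∀ x, 0 ≤ F x) :
    ∃ m, 0 ≤ m ∧ μ.real {x | m < F x} ≤ 1 / 2 ∧ μ.real {x | F x < m} ≤ 1 / 2 := by
  set S : Set ℝ := {s | 0 ≤ s ∧ μ.real {x | s < F x} ≤ 1 / 2} with hS
  have hanti : Antitone fun s => μ.real {x | s < F x} := fun s t hst =>
    measureReal_mono fun x hx => lt_of_le_of_lt hst (Set.mem_ofPred.1 hx)
  have hreal : ∀ {s : ℕ → Set α} {A : Set α}, Monotone s → ⋃ n, s n = A →
      Tendsto (fun n => μ.real (s n)) atTop (𝓝 (μ.real A)) := fun hs hA => by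
    rw [← hA]
    exact (ENNReal.tendsto_toReal (measure_ne_top _ _)).comp (tendsto_measure_iUnion_atTop hs)
  have hne : S.Nonempty := by
    have hlim : Tendsto (fun n : ℕ => μ.real {x | F x ≤ n}) atTop (𝓝 (μ.real Set.univ)) := by
      refine hreal (fun n k hnk x hx => le_trans (Set.mem_ofPred.1 hx) (by exact_mod_cast hnk)) ?_
      exact Set.eq_univ_of_forall fun x => Set.mem_iUnion.2 (exists_nat_ge (F x))
    rw [probReal_univ] at hlim
    obtain ⟨n, hn⟩ := (hlim.eventually_const_lt (show (1 / 2 : ℝ) < 1 by norm_num)).exists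
    refine ⟨n, n.cast_nonneg, ?_⟩
    have hc : {x | (n : ℝ) < F x} = {x | F x ≤ n}ᶜ := by ext x; simp
    rw [hc, probReal_compl_eq_one_sub (measurableSet_le hF measurable_const)]
    linarith
  have hbdd : BddBelow S := ⟨0, fun s hs => hs.1⟩
  set m := sInf S with hm
  have hm0 : 0 ≤ m := le_csInf hne fun s hs => hs.1
  have hmono : ∀ {n k : ℕ}, n ≤ k → 1 / ((k : ℝ) + 1) ≤ 1 / ((n : ℝ) + 1) := fun h => by gcongr
  refine ⟨m, hm0, ?_, ?_⟩
  · refine le_of_tendsto' (hreal (s := fun n : ℕ => {x | m + 1 / ((n : ℝ) + 1) < F x})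
      (fun n k hnk x hx => ?_) ?_) fun n => ?_
    · have h1 : m + 1 / ((n : ℝ) + 1) < F x := hx
      have h2 := hmono hnk
      change m + 1 / ((k : ℝ) + 1) < F x
      linarith
    · ext x
      simp only [Set.mem_iUnion, Set.mem_ofPred_eq]
      constructor
      · rintro ⟨n, hn⟩
        have : 0 < 1 / ((n : ℝ) + 1) := Nat.one_div_pos_of_nat
        linarith
      · intro hx
        obtain ⟨n, hn⟩ := exists_nat_one_div_lt (sub_pos.2 hx)
        exact ⟨n, by linarith⟩
    · have : 0 < 1 / ((n : ℝ) + 1) := Nat.one_div_pos_of_nat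
      obtain ⟨s, hs, hsm⟩ := exists_lt_of_csInf_lt hne (show sInf S < m + 1 / ((n : ℝ) + 1) by
        rw [← hm]; linarith)
      exact (hanti hsm.le).trans hs.2
  · refine le_of_tendsto' (hreal (s := fun n : ℕ => {x | F x ≤ m - 1 / ((n : ℝ) + 1)})
      (fun n k hnk x hx => ?_) ?_) fun n => ?_
    · have h1 : F x ≤ m - 1 / ((n : ℝ) + 1) := hx
      have h2 := hmono hnk
      change F x ≤ m - 1 / ((k : ℝ) + 1)
      linarith
    · ext x
      simp only [Set.mem_iUnion, Set.mem_ofPred_eq]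
      constructor
      · rintro ⟨n, hn⟩
        have : 0 < 1 / ((n : ℝ) + 1) := Nat.one_div_pos_of_nat
        linarith
      · intro hx
        obtain ⟨n, hn⟩ := exists_nat_one_div_lt (sub_pos.2 hx)
        exact ⟨n, by linarith⟩
    · have hpos : 0 < 1 / ((n : ℝ) + 1) := Nat.one_div_pos_of_nat
      by_cases hneg : m - 1 / ((n : ℝ) + 1) < 0
      · have : {x | F x ≤ m - 1 / ((n : ℝ) + 1)} = ∅ :=
          Set.eq_empty_of_forall_notMem fun x hx =>
            absurd (h0 x) (not_le.2 ((Set.mem_ofPred.1 hx).trans_lt hneg))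
        rw [this]
        simp
      · have hnS : m - 1 / ((n : ℝ) + 1) ∉ S := fun hs => by
          have := csInf_le hbdd hs
          linarith
        have h1 : 1 / 2 < μ.real {x | m - 1 / ((n : ℝ) + 1) < F x} := by
          by_contra hcon
          exact hnS ⟨not_lt.1 hneg, not_lt.1 hcon⟩
        have hc : {x | F x ≤ m - 1 / ((n : ℝ) + 1)} = {x | m - 1 / ((n : ℝ) + 1) < F x}ᶜ := by
          ext x; simp
        rw [hc, probReal_compl_eq_one_sub (measurableSet_lt measurable_const hF)]
        linarith

/-- Lower bound for the entropy of `F^q` in terms of the mass of `{F = 1}`, by the dual formula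
`Ent g ≥ ∫ g log w` for `∫ w ≤ 1`, with `w = a^(-1/2)` on `{F = 1}`, `w = 1` on the rest of
`{0 < F}`, and `w = 0` on `{F = 0}`, where `a = μ {F = 1}`. -/
theorem negMulLog_measureReal_le_entropy {α : Type*} [MeasurableSpace α] {μ : Measure α}
    [IsProbabilityMeasure μ] {F : α → ℝ} (hF : Measurable F) (h0 : ∀ x, 0 ≤ F x) {q : ℝ}
    (hq : 0 < q) (ha0 : 0 < μ.real {x | F x = 1}) (hhalf : μ.real {x | 0 < F x} ≤ 1 / 2)
    (hint : Integrable (fun x => F x ^ q) μ)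
    (hent : Integrable (fun x => F x ^ q * Real.log (F x ^ q / ∫ y, F y ^ q ∂μ)) μ) :
    Real.negMulLog (μ.real {x | F x = 1}) / 2 ≤
      ∫ x, F x ^ q * Real.log (F x ^ q / ∫ y, F y ^ q ∂μ) ∂μ := by
  set A : Set α := {x | F x = 1} with hA
  set S : Set α := {x | 0 < F x} with hS
  have hAm : MeasurableSet A := measurableSet_eq_fun hF measurable_const
  have hSm : MeasurableSet S := measurableSet_lt measurable_const hF
  set a := μ.real A with ha
  set M := ∫ y, F y ^ q ∂μ with hM
  have hAS : A ⊆ S := fun x hx => by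
    have : F x = 1 := hx
    change 0 < F x
    rw [this]; exact one_pos
  have hFq0 : ∀ x, 0 ≤ F x ^ q := fun x => Real.rpow_nonneg (h0 x) q
  have haM : a ≤ M := by
    have : ∫ x, A.indicator 1 x ∂μ ≤ M := by
      refine integral_mono ((integrable_const (1 : ℝ)).indicator hAm) hint fun x => ?_
      refine Set.indicator_apply_le' (fun hx => ?_) fun _ => hFq0 x
      have : F x = 1 := hx
      simp [this]
    rwa [integral_indicator_one hAm] at this
  have hM0 : 0 < M := ha0.trans_le haM
  set r := √a with hr
  have hr0 : 0 < r := Real.sqrt_pos.2 ha0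
  have hra : r * r = a := Real.mul_self_sqrt ha0.le
  set d := -Real.log r - M / r + M with hd
  have hlow : ∀ x, F x ^ q - S.indicator (fun _ => M) x + A.indicator (fun _ => d) x ≤
      F x ^ q * Real.log (F x ^ q / M) := fun x => by
    by_cases hxS : x ∈ S
    · rw [Set.indicator_of_mem hxS]
      by_cases hxA : x ∈ A
      · have h1 : F x = 1 := hxA
        rw [Set.indicator_of_mem hxA, h1, Real.one_rpow, one_mul]
        have h2 := sub_le_mul_log_div (x := 1) (a := M / r) zero_le_one (by positivity)
        rw [one_mul, one_div_div, Real.log_div hr0.ne' hM0.ne'] at h2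
        rw [one_div, Real.log_inv]
        linarith
      · rw [Set.indicator_of_notMem hxA, add_zero]
        exact sub_le_mul_log_div (hFq0 x) hM0
    · have hz : F x = 0 := le_antisymm (not_lt.1 hxS) (h0 x)
      rw [Set.indicator_of_notMem hxS, Set.indicator_of_notMem fun hxA => hxS (hAS hxA), hz,
        Real.zero_rpow hq.ne']
      simp
  have hiS : Integrable (S.indicator fun _ => M) μ := (integrable_const M).indicator hSm
  have hiA : Integrable (A.indicator fun _ => d) μ := (integrable_const d).indicator hAm
  have h1 := integral_mono ((hint.sub hiS).add hiA) hent hlow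
  have h2 : ∫ x, ((fun x => F x ^ q) - (S.indicator fun _ => M) + A.indicator fun _ => d) x ∂μ
      = M - μ.real S * M + a * d := by
    rw [integral_add' (hint.sub hiS) hiA, integral_sub' hint hiS, integral_indicator_const _ hSm,
      integral_indicator_const _ hAm]
    simp only [smul_eq_mul, hM, ha]
  rw [h2] at h1
  have h3 : Real.negMulLog a / 2 = a * (-Real.log r) := by
    rw [hr, Real.log_sqrt ha0.le, Real.negMulLog]
    ring
  have h4 : a * (M / r) = r * M := by rw [← hra]; field_simp
  -- it remains to use `μ S ≤ 1/2` and `√a - a ≤ 1/2`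
  have h5 : 0 ≤ M * (1 - μ.real S - r + a) := by
    refine mul_nonneg hM0.le ?_
    nlinarith [sq_nonneg (r - 1 / 2)]
  have h6 : a * d = a * (-Real.log r) - r * M + a * M := by
    rw [hd, mul_add, mul_sub, h4]
  rw [h3]
  nlinarith

theorem mul_log_le_two_mul_negMulLog {t a : ℝ} (ht : 0 < t) (ht2 : t < 1 / 2) (hta : t ≤ a)
    (ha : a ≤ 1 / 2) : t * Real.log (1 / t) ≤ 2 * Real.negMulLog a := by
  have h := Real.concaveOn_negMulLog.min_le_of_mem_Icc (Set.mem_Ici.2 ht.le)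
    (Set.mem_Ici.2 (show (0 : ℝ) ≤ 1 / 2 by norm_num)) (Set.mem_Icc.2 ⟨hta, ha⟩)
  have hl2 := Real.log_two_gt_d9
  have hl2' := Real.log_two_lt_d9
  have heq : t * Real.log (1 / t) = Real.negMulLog t := by
    rw [Real.negMulLog, one_div, Real.log_inv]; ring
  have hhalf : Real.negMulLog (1 / 2) = Real.log 2 / 2 := by
    rw [Real.negMulLog, one_div, Real.log_inv]; ring
  have ht0 : 0 ≤ Real.negMulLog t := Real.negMulLog_nonneg ht.le (by linarith)
  rw [heq]
  rw [hhalf] at h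
  rcases min_le_iff.1 h with h | h
  · linarith
  · have h1 : Real.negMulLog t ≤ 1 / 2 := by
      have h2 : Real.log (1 / (2 * t)) ≤ 1 / (2 * t) - 1 :=
        Real.log_le_sub_one_of_pos (by positivity)
      rw [one_div, Real.log_inv, Real.log_mul two_ne_zero ht.ne'] at h2
      calc Real.negMulLog t = t * (-Real.log t) := by rw [Real.negMulLog]; ring
        _ ≤ t * (Real.log 2 + ((2 * t)⁻¹ - 1)) := by gcongr; linarith
        _ = t * (Real.log 2 - 1) + 1 / 2 := by field_simp; ring
        _ ≤ 1 / 2 := by nlinarith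
    linarith

end Entropy

/-! ### The log-Sobolev and capacity inequalities -/

section LogSobolev

variable {E : Type*} [NormedAddCommGroup E] [NormedSpace ℝ E] [FiniteDimensional ℝ E]
  [MeasurableSpace E] [BorelSpace E] {μ : Measure E} [IsProbabilityMeasure μ] {p q c₀ : ℝ}

/-- The `q`-log-Sobolev inequality. The central estimate is applied to the positive and the negative
part of `F - m`, for a median `m` of `F`. -/
theorem integrable_and_mul_entropy_le_lintegral_gradNorm (hpq : p.HolderConjugate q) (hq2 : q ≤ 2)
    (hc₀ : 0 < c₀) (hiso : ∀ A : Set E, MeasurableSet A →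
      ENNReal.ofReal (c₀ * logProfile q (minMass μ A)) ≤ minkowskiBoundary μ A)
    {F : E → ℝ} (hF : LocallyLipschitz F) (h0 : ∀ x, 0 ≤ F x)
    (hK : ∫⁻ x, gradNorm F x ^ q ∂μ ≠ ∞) :
    Integrable (fun x => F x ^ q) μ ∧
      Integrable (fun x => F x ^ q * Real.log (F x ^ q / ∫ y, F y ^ q ∂μ)) μ ∧
      ENNReal.ofReal (1 / 15360 * c₀ ^ q *
        ∫ x, F x ^ q * Real.log (F x ^ q / ∫ y, F y ^ q ∂μ) ∂μ) ≤ ∫⁻ x, gradNorm F x ^ q ∂μ := by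
  have hq1 : 1 < q := hpq.symm.lt
  have hFm : Measurable F := hF.continuous.measurable
  obtain ⟨m, hm, hm1, hm2⟩ := exists_median (μ := μ) hFm h0
  set K := ∫⁻ x, gradNorm F x ^ q ∂μ with hKdef
  have hcq : 0 < c₀ ^ q := by positivity
  set κ := 128 * K.toReal / c₀ ^ q with hκ
  have hκ0 : 0 ≤ κ := by positivity
  have hcκ : ENNReal.ofReal (c₀ ^ q) * ENNReal.ofReal κ = 128 * K := by
    rw [← ENNReal.ofReal_mul hcq.le, hκ, mul_div_cancel₀ _ hcq.ne',
      ENNReal.ofReal_mul (by norm_num), ENNReal.ofReal_toReal hK]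
    norm_num
  have hpart : ∀ {G : E → ℝ}, LocallyLipschitz G → (∀ x, 0 ≤ G x) →
      (∀ x y, |G y - G x| ≤ |F y - F x|) → μ.real {x | 0 < G x} ≤ 1 / 2 → ∀ b, κ < b →
      ENNReal.ofReal (c₀ ^ q) * ∫⁻ x, ENNReal.ofReal (G x ^ q * levelLog q b (G x)) ∂μ
        ≤ 64 * K := by
    intro G hG hG0 hGF hGhalf b hb
    have hgrad : ∫⁻ x, gradNorm G x ^ q ∂μ ≤ K := by
      refine lintegral_mono fun x => ?_
      have := gradNorm_le_of_abs_sub_le hGF x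
      gcongr
    refine (rpow_mul_lintegral_levelLog_le hpq hq2 hc₀ hiso hG hG0 hGhalf
      (hκ0.trans_lt hb) ?_).trans (mul_le_mul_right hgrad 64)
    refine (mul_le_mul_right hgrad 128).trans ?_
    rw [← hcκ]
    gcongr
  obtain ⟨hint, hent, hle⟩ := integrable_and_entropy_le (μ := μ) hFm h0 hq1.le hq2 hm hκ0
    fun b hb => by
      have hsub : LocallyLipschitz fun x => F x - m := by
        simpa [sub_eq_add_neg] using hF.add (LocallyLipschitz.const (-m))
      have hsub' : LocallyLipschitz fun x => m - F x := by
        simpa [sub_eq_add_neg] using (LocallyLipschitz.const m).add hF.neg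
      have hpos := hpart (G := fun x => max (F x - m) 0) (hsub.max_const 0)
        (fun x => le_max_right _ _)
        (fun x y => by
          refine (abs_max_sub_max_le_max _ _ _ _).trans (max_le (le_of_eq ?_) (by simp))
          congr 1; ring)
        (by simpa [lt_max_iff] using hm1) b hb
      have hneg := hpart (G := fun x => max (m - F x) 0) (hsub'.max_const 0)
        (fun x => le_max_right _ _)
        (fun x y => by
          refine (abs_max_sub_max_le_max _ _ _ _).trans (max_le (le_of_eq ?_) (by simp))
          rw [abs_sub_comm]; congr 1; ring)
        (by simpa [lt_max_iff] using hm2) b hb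
      have hmeas : Measurable fun x =>
          ENNReal.ofReal (max (F x - m) 0 ^ q * levelLog q b (max (F x - m) 0)) := by
        have h1 : Measurable fun x => max (F x - m) 0 := (hFm.sub_const m).max measurable_const
        exact ((h1.pow_const q).mul
          ((continuous_levelLog (by linarith)).measurable.comp h1)).ennreal_ofReal
      have hsum : ∫⁻ x, ENNReal.ofReal (|F x - m| ^ q * levelLog q b |F x - m|) ∂μ ≤
          ∫⁻ x, ENNReal.ofReal (max (F x - m) 0 ^ q * levelLog q b (max (F x - m) 0)) ∂μ +
          ∫⁻ x, ENNReal.ofReal (max (m - F x) 0 ^ q * levelLog q b (max (m - F x) 0)) ∂μ := by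
        rw [← lintegral_add_left hmeas]
        refine lintegral_mono fun x => ?_
        rcases le_total m (F x) with h | h
        · rw [abs_of_nonneg (sub_nonneg.2 h), max_eq_left (sub_nonneg.2 h)]
          exact le_self_add
        · rw [abs_of_nonpos (sub_nonpos.2 h), neg_sub, max_eq_left (a := m - F x) (sub_nonneg.2 h)]
          exact le_add_self
      refine (ENNReal.mul_le_mul_iff_right (ENNReal.ofReal_pos.2 hcq).ne'
        ENNReal.ofReal_ne_top).1 ?_
      calc _ ≤ _ := mul_le_mul_right hsum (ENNReal.ofReal (c₀ ^ q))
        _ ≤ 64 * K + 64 * K := by rw [mul_add]; exact add_le_add hpos hneg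
        _ = 128 * K := by rw [← add_mul]; norm_num
        _ = _ := hcκ.symm
  refine ⟨hint, hent, ?_⟩
  rw [← ENNReal.ofReal_toReal hK]
  refine ENNReal.ofReal_le_ofReal ?_
  calc _ ≤ 1 / 15360 * c₀ ^ q * (120 * κ) := by gcongr
    _ = K.toReal := by rw [hκ]; field_simp; norm_num

/-- The `L^q` capacity inequality: the `q`-log-Sobolev inequality for a function which vanishes with
probability at least `1/2`, combined with a lower bound for its entropy. -/
theorem mul_log_le_lintegral_gradNorm_rpow (hpq : p.HolderConjugate q) (hq2 : q ≤ 2)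
    (hc₀ : 0 < c₀) (hiso : ∀ A : Set E, MeasurableSet A →
      ENNReal.ofReal (c₀ * logProfile q (minMass μ A)) ≤ minkowskiBoundary μ A)
    {F : E → ℝ} {t : ℝ} (hF : LocallyLipschitz F) (h0 : ∀ x, 0 ≤ F x) (ht : 0 < t)
    (ht2 : t < 1 / 2) (h1 : t ≤ μ.real {x | F x = 1}) (hz : 1 / 2 ≤ μ.real {x | F x = 0}) :
    ENNReal.ofReal (1 / 61440 * c₀ ^ q * (t * Real.log (1 / t))) ≤ ∫⁻ x, gradNorm F x ^ q ∂μ := by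
  by_cases hK : ∫⁻ x, gradNorm F x ^ q ∂μ = ∞
  · rw [hK]; exact le_top
  obtain ⟨hint, hent, hle⟩ :=
    integrable_and_mul_entropy_le_lintegral_gradNorm hpq hq2 hc₀ hiso hF h0 hK
  refine le_trans (ENNReal.ofReal_le_ofReal ?_) hle
  have hhalf := measureReal_setOf_lt_le_half (μ := μ) hF.continuous le_rfl hz
  have h2 := negMulLog_measureReal_le_entropy hF.continuous.measurable h0 hpq.symm.pos
    (ht.trans_le h1) hhalf hint hent
  have h3 := mul_log_le_two_mul_negMulLog ht ht2 h1 ((measureReal_mono fun x hx => by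
    have : F x = 1 := hx
    change 0 < F x
    rw [this]; exact one_pos).trans hhalf)
  calc 1 / 61440 * c₀ ^ q * (t * Real.log (1 / t))
      = 1 / 15360 * c₀ ^ q * (t * Real.log (1 / t) / 4) := by ring
    _ ≤ _ := by gcongr; linarith

end LogSobolev

theorem mainTheorem6 :
    ∃ c : ℝ, 0 < c ∧ ∃ c' : ℝ, 0 < c' ∧
      ∀ (E : Type*) [NormedAddCommGroup E] [NormedSpace ℝ E] [FiniteDimensional ℝ E]
        [MeasurableSpace E] [BorelSpace E] (μ : Measure E) [IsProbabilityMeasure μ]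
        (p q c₀ : ℝ), 2 ≤ p → 1 / q = 1 - 1 / p → 0 < c₀ →
        (∀ A : Set E, MeasurableSet A →
          ENNReal.ofReal (c₀ * logProfile q (minMass μ A)) ≤ minkowskiBoundary μ A) →
        -- (1) the `L¹` inequality
        (∀ (F : E → ℝ) (t : ℝ), LocallyLipschitz F → (∀ x, 0 ≤ F x ∧ F x ≤ 1) →
          0 < t → t < 1 / 2 → t ≤ μ.real {x | F x = 1} → 1 / 2 ≤ μ.real {x | F x = 0} →
          ENNReal.ofReal (c₀ * min (logProfile q t) (logProfile q (1 / 2)))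
              ≤ ∫⁻ x, gradNorm F x ∂μ ∧
          (t ≤ 1 / 4 ∨ 1 / Real.log 2 ≤ q →
            ENNReal.ofReal (c₀ * (t * Real.log (1 / t) ^ (1 / q)))
              ≤ ∫⁻ x, gradNorm F x ∂μ)) ∧
        -- (2) the `L^q` capacity inequality
        (∀ (F : E → ℝ) (t : ℝ), LocallyLipschitz F → (∀ x, 0 ≤ F x ∧ F x ≤ 1) →
          0 < t → t < 1 / 2 → t ≤ μ.real {x | F x = 1} → 1 / 2 ≤ μ.real {x | F x = 0} →
          ENNReal.ofReal (c * c₀ ^ q * (t * Real.log (1 / t)))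
              ≤ ∫⁻ x, gradNorm F x ^ q ∂μ) ∧
        -- (3) the `q`-log-Sobolev inequality
        (∀ F : E → ℝ, LocallyLipschitz F → (∀ x, 0 ≤ F x) →
          (∫⁻ x, gradNorm F x ^ q ∂μ ≠ ∞ →
            Integrable (fun x => F x ^ q) μ ∧
            Integrable (fun x => F x ^ q * Real.log (F x ^ q / ∫ y, F y ^ q ∂μ)) μ) ∧
          ENNReal.ofReal
              (c' * c₀ ^ q * ∫ x, F x ^ q * Real.log (F x ^ q / ∫ y, F y ^ q ∂μ) ∂μ)
            ≤ ∫⁻ x, gradNorm F x ^ q ∂μ) := by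
  refine ⟨1 / 61440, by norm_num, 1 / 15360, by norm_num, ?_⟩
  intro E _ _ _ _ _ μ _ p q c₀ hp hpq' hc₀ hiso
  have hp0 : 0 < p := by linarith
  have hp1 : 1 / p ≤ 1 / 2 := one_div_le_one_div_of_le two_pos hp
  have hpq : p.HolderConjugate q := by
    refine Real.holderConjugate_iff.2 ⟨by linarith, ?_⟩
    rw [← one_div, ← one_div, hpq']
    ring
  have hq : 1 < q := hpq.symm.lt
  have hq2 : q ≤ 2 := by
    have h1 : 1 / 2 ≤ 1 / q := by linarith
    exact (one_div_le_one_div two_pos (by linarith)).1 h1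
  refine ⟨fun F t hF h01 ht ht2 h1 hz => ?_, fun F t hF h01 ht ht2 h1 hz =>
    mul_log_le_lintegral_gradNorm_rpow hpq hq2 hc₀ hiso hF (fun x => (h01 x).1) ht ht2 h1 hz,
    fun F hF h0 => ⟨fun hK => ?_, ?_⟩⟩
  · have h := ofReal_min_logProfile_le_lintegral_gradNorm (by linarith) hc₀ hiso hF h01 ht h1 hz
    refine ⟨h, fun hcase => ?_⟩
    rwa [min_eq_left (logProfile_le_logProfile_half hq.le ht ht2 hcase)] at h
  · obtain ⟨hint, hent, -⟩ :=
      integrable_and_mul_entropy_le_lintegral_gradNorm hpq hq2 hc₀ hiso hF h0 hK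
    exact ⟨hint, hent⟩
  · by_cases hK : ∫⁻ x, gradNorm F x ^ q ∂μ = ∞
    · rw [hK]; exact le_top
    · exact (integrable_and_mul_entropy_le_lintegral_gradNorm hpq hq2 hc₀ hiso hF h0 hK).2.2
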